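/- Let $r=\{r(t)\}_{t\ge 0}$ be the real centered Gaussian process with covariance $$\mathbb E\big(r(t)r(t')\big)=\sqrt{t+t'}-\sqrt{t-t'},\qquad t\ge t'\ge 0 .$$ Such a process exists, it has a version with continuous paths, and it is self-similar of order $\tfrac14$: for every $a>0$, $\{r(at)\}_{t\ge0}$ and $\{a^{1/4}r(t)\}_{t\ge0}$ are equal in law. Moreover it admits the following three representations, where $\overset{\rm law}{=}$ means that all finite dimensional distributions coincide. (1) Let $\{\nu(t)\}_{t\in\mathbb R}$ be a two-sided fractional Brownian motion with Hurst parameter $\tfrac14$, i.e. a centered Gaussian process with $\mathbb E(\nu(t)\nu(s))=\tfrac12\big(|t|^{1/2}+|s|^{1/2}-|t-s|^{1/2}\big)$, and let $\nu_O(t)=\tfrac12(\nu(t)-\nu(-t))$ be its odd part. Then $\{r(t)\}_{t\ge0}\overset{\rm law}{=}\{2\nu_O(t)\}_{t\ge0}$. (2) Let $\dot W$ be a space-time white noise on $\mathbb R\times[0,\infty)$, i.e. a centered Gaussian family $\dot W(g)=\int g\,\mathrm dW$, $g\in L^2(\mathbb R\times[0,\infty))$, with $\mathbb E(\dot W(f)\dot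 W(g))=\langle f,g\rangle_{L^2}$. The stochastic heat equation $\partial_t h=\tfrac12\partial_x^2h+\dot W$ on $\mathbb R$ with $h(x,0)=0$ has a mild solution, that is, $h(x,t)=\int_0^t\!\int_{\mathbb R}\frac{e^{-(x-y)^2/(2(t-s))}}{\sqrt{2\pi(t-s)}}\,\mathrm dW_{y,s}$ almost surely for each $x\in\mathbb R$ and $t>0$, and $h(x,0)=0$ almost surely; and every such solution satisfies $\{r(t)\}_{t\ge0}\overset{\rm law}{=}\{(2\pi)^{1/4}h(0,t)\}_{t\ge0}$. (3) Let $b$ be a standard Brownian motion. For every $t\ge 0$ the integrand below is in $L^2(0,t)$, so that the Wiener integral exists, and $$\{r(t)\}_{t\ge0}\overset{\rm law}{=}\Big\{c\int_0^t\frac{s^{1/4}}{(t^2-s^2)^{1/4}}\,\mathrm db(s)\Big\}_{t\ge0},\qquad c=\Big(\tfrac12B\big(\tfrac34,\tfrac34\big)\Big)^{-1/2},$$ with $B$ the Euler beta function. -/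

import Mathlib

open MeasureTheory ProbabilityTheory Filter Topology
open scoped NNReal ENNReal

noncomputable section

/-- Two real processes, possibly on different probability spaces, are equal in law:
all their finite dimensional distributions coincide. -/
def ProcessEqLaw {T Ω Ω' : Type*} [MeasurableSpace Ω] [MeasurableSpace Ω']
    (X : T → Ω → ℝ) (P : Measure Ω) (Y : T → Ω' → ℝ) (Q : Measure Ω') : Prop :=
  ∀ I : Finset T,
    IdentDistrib (fun ω ↦ I.restrict (X · ω)) (fun ω ↦ I.restrict (Y · ω)) P Q

/-- `r` is a centered Gaussian process on `[0, ∞)` with covariance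
`√(t + t') - √(t - t')` for `t ≥ t'`. -/
structure IsRootProcess {Ω : Type*} [MeasurableSpace Ω] (r : ℝ≥0 → Ω → ℝ) (P : Measure Ω) :
    Prop where
  gaussian : IsGaussianProcess r P
  centered : ∀ t, ∫ ω, r t ω ∂P = 0
  covariance : ∀ t t' : ℝ≥0, t' ≤ t →
    cov[r t, r t'; P] = √((t : ℝ) + (t' : ℝ)) - √((t : ℝ) - (t' : ℝ))

/-- `Y` is a continuous version of `X`. -/
structure IsContinuousVersion {Ω : Type*} [MeasurableSpace Ω] (Y X : ℝ≥0 → Ω → ℝ)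
    (P : Measure Ω) : Prop where
  measurable : ∀ t, Measurable (Y t)
  continuous : ∀ ω, Continuous (Y · ω)
  ae_eq : ∀ t, Y t =ᵐ[P] X t

/-- Self-similarity of order `κ`: for `a > 0`, the processes `X (a t)` and `a ^ κ X t` are equal
in law. -/
def IsSelfSimilar {Ω : Type*} [MeasurableSpace Ω] (κ : ℝ) (X : ℝ≥0 → Ω → ℝ)
    (P : Measure Ω) : Prop :=
  ∀ a : ℝ≥0, 0 < a →
    ProcessEqLaw (fun t ω ↦ X (a * t) ω) P (fun t ω ↦ (a : ℝ) ^ κ * X t ω) P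

/-- `ν` is a two sided fractional Brownian motion with Hurst parameter `H`. -/
structure IsTwoSidedFBM {Ω : Type*} [MeasurableSpace Ω] (H : ℝ) (ν : ℝ → Ω → ℝ)
    (P : Measure Ω) : Prop where
  gaussian : IsGaussianProcess ν P
  centered : ∀ t, ∫ ω, ν t ω ∂P = 0
  covariance : ∀ t s : ℝ,
    cov[ν t, ν s; P] = (1 / 2) * (|t| ^ (2 * H) + |s| ^ (2 * H) - |t - s| ^ (2 * H))

/-- The odd part of a process indexed by `ℝ`. -/
def oddPart {Ω : Type*} (X : ℝ → Ω → ℝ) (t : ℝ) (ω : Ω) : ℝ := (1 / 2) * (X t ω - X (-t) ω)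

/-- Gaussian white noise with intensity `μ`: a centered Gaussian family `W g = ∫ g dW`,
`g ∈ L²(μ)`, whose covariance is the inner product of `L²(μ)`. -/
structure IsWhiteNoise {E Ω : Type*} [MeasurableSpace E] [MeasurableSpace Ω] (μ : Measure E)
    (W : Lp ℝ 2 μ → Ω → ℝ) (P : Measure Ω) : Prop where
  gaussian : IsGaussianProcess W P
  centered : ∀ g, ∫ ω, W g ω ∂P = 0
  covariance : ∀ f g, cov[W f, W g; P] = inner ℝ f g

/-- Lebesgue measure on `ℝ × [0, ∞)`; points are pairs `(y, s)` of a position and a time. -/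
def spaceTimeVolume : Measure (ℝ × ℝ) :=
  (volume : Measure ℝ).prod ((volume : Measure ℝ).restrict (Set.Ici 0))

/-- The Green function of `∂ₜ - ½ ∂ₓ²` on `ℝ`, at time `t > 0`. -/
def heatKernel (t x : ℝ) : ℝ := Real.exp (-x ^ 2 / (2 * t)) / √(2 * Real.pi * t)

/-- The integrand `(y, s) ↦ 1_{0 ≤ s < t} G(t - s, x - y)` of the stochastic convolution. -/
def convolutionKernel (x t : ℝ) (q : ℝ × ℝ) : ℝ :=
  if 0 ≤ q.2 ∧ q.2 < t then heatKernel (t - q.2) (x - q.1) else 0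

/-- `h` is the (mild) solution of `∂ₜ h = ½ ∂ₓ² h + Ẇ`, `h(x, 0) = h₀(x)`, on `ℝ × [0, ∞)`:
for `t > 0`, almost surely,
`h(x, t) = ∫ G(t, x - y) h₀(y) dy + ∫₀ᵗ ∫ G(t - s, x - y) dW(y, s)`,
where both integrals are required to make sense. -/
structure IsStochasticHeatSolution {Ω : Type*} [MeasurableSpace Ω]
    (W : Lp ℝ 2 spaceTimeVolume → Ω → ℝ) (P : Measure Ω) (h₀ : ℝ → ℝ)
    (h : ℝ → ℝ≥0 → Ω → ℝ) : Prop where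
  initial : ∀ x, ∀ᵐ ω ∂P, h x 0 ω = h₀ x
  integrable : ∀ (x : ℝ) (t : ℝ≥0), 0 < t → Integrable (fun y ↦ heatKernel t (x - y) * h₀ y)
  mild : ∀ (x : ℝ) (t : ℝ≥0), 0 < t →
    ∃ hG : MemLp (convolutionKernel x t) 2 spaceTimeVolume,
      ∀ᵐ ω ∂P, h x t ω = (∫ y, heatKernel t (x - y) * h₀ y) + W (hG.toLp _) ω

/-- A step function `∑ i, coeff i • 1_{(left i, right i]}` on `[0, ∞)`. -/
structure StepFun where
  size : ℕ
  coeff : Fin size → ℝ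
  left : Fin size → ℝ≥0
  right : Fin size → ℝ≥0
  left_le_right : ∀ i, left i ≤ right i

/-- The function represented by a step function. -/
def StepFun.eval (φ : StepFun) (s : ℝ) : ℝ :=
  ∑ i, (Set.Ioc (φ.left i : ℝ) (φ.right i : ℝ)).indicator (fun _ ↦ φ.coeff i) s

/-- The elementary stochastic integral `∫ φ db = ∑ i, coeff i * (b (right i) - b (left i))`. -/
def StepFun.integral {Ω : Type*} (φ : StepFun) (b : ℝ≥0 → Ω → ℝ) (ω : Ω) : ℝ :=
  ∑ i, φ.coeff i * (b (φ.right i) ω - b (φ.left i) ω)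

/-- `X` is (a version of) the Wiener integral `∫₀^∞ f db` of `f ∈ L²(0, ∞)`: it is the limit in
`L²(P)` of the elementary integrals of step functions that converge to `f` in `L²(0, ∞)`. -/
def HasWienerIntegral {Ω : Type*} [MeasurableSpace Ω] (b : ℝ≥0 → Ω → ℝ) (P : Measure Ω)
    (f : ℝ → ℝ) (X : Ω → ℝ) : Prop :=
  MemLp f 2 (volume.restrict (Set.Ioi 0)) ∧ MemLp X 2 P ∧
    ∃ φ : ℕ → StepFun,
      Tendsto (fun n ↦ eLpNorm (fun s ↦ (φ n).eval s - f s) 2 (volume.restrict (Set.Ioi 0)))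
        atTop (𝓝 0) ∧
      Tendsto (fun n ↦ eLpNorm (fun ω ↦ (φ n).integral b ω - X ω) 2 P) atTop (𝓝 0)

/-- The integrand `s ↦ 1_{0 < s < t} s^{1/4} / (t² - s²)^{1/4}`. -/
def rootKernel (t s : ℝ) : ℝ :=
  if 0 < s ∧ s < t then s ^ (1 / 4 : ℝ) / (t ^ 2 - s ^ 2) ^ (1 / 4 : ℝ) else 0

end

/-! A centered Gaussian process is determined in law by its covariance
(`IsGaussianProcess.processEqLaw`). Self-similarity and the three representations therefore reduce
to two tasks: showing that the process is Gaussian, and computing its covariance.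

For fractional Brownian motion this is bilinearity. For the heat equation, the semigroup property
gives `∫ G(t-s,y) G(t'-s,y) dy = (2π(t+t'-2s))^(-1/2)`, and integrating over `0 < s < t'` yields
`(2π)^(-1/2) (√(t+t') - √(t-t'))`. The same computation proves existence: an isonormal process on
`L²(ℝ × [0,∞))` is a white noise, built from i.i.d. normals along a Hilbert basis
(`exists_isonormalProcess`).

For the Wiener integral, the Wiener isometry reduces the covariance to `∫ rootKernel t s *
rootKernel t' s ds`. A substitution turns this into `(t'/√t) * landenIntegral κ` with `κ² = 1 -
(t'/t)²`. A Landen-type transformation shows that `landenIntegral κ * √(1+κ)` does not depend on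
`κ`, and `κ = 1` gives a beta integral (`landenIntegral_mul_sqrt_eq`, `landenIntegral_one`).

The continuous version comes from `Var(r s - r t) ≤ 2 √|s-t|`, Gaussian moments and
Kolmogorov–Chentsov. Gaussianity of stochastic integrals rests on `isClosed_setOf_hasGaussianLaw`.
-/

/-! ### Gaussian laws: determination by covariance and closedness in `L²`. -/

section GaussianProcesses

variable {T Ω Ω' : Type*} [MeasurableSpace Ω] [MeasurableSpace Ω'] {P : Measure Ω}
  {Q : Measure Ω'}

/-- Gaussian processes with the same mean and covariance are equal in law. -/
theorem ProbabilityTheory.IsGaussianProcess.processEqLaw {X : T → Ω → ℝ} {Y : T → Ω' → ℝ}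
    (hX : IsGaussianProcess X P) (hY : IsGaussianProcess Y Q)
    (hm : ∀ t, ∫ ω, X t ω ∂P = ∫ ω, Y t ω ∂Q)
    (hc : ∀ s t, cov[X s, X t; P] = cov[Y s, Y t; Q]) :
    ProcessEqLaw X P Y Q := by
  intro I
  have hXm : AEMeasurable (fun ω ↦ I.restrict (X · ω)) P :=
    aemeasurable_pi_lambda _ fun _ ↦ hX.aemeasurable _
  have hYm : AEMeasurable (fun ω ↦ I.restrict (Y · ω)) Q :=
    aemeasurable_pi_lambda _ fun _ ↦ hY.aemeasurable _
  refine ⟨hXm, hYm, ?_⟩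
  -- The covariance bilinear form lives on an inner product space, so the laws are compared on
  -- Euclidean space instead of the sup-normed product.
  apply (MeasurableEquiv.toLp 2 (_ → ℝ)).map_measurableEquiv_injective
  rw [MeasurableEquiv.coe_toLp, ← PiLp.coe_symm_continuousLinearEquiv 2 ℝ]
  have := (hX.hasGaussianLaw I).isGaussian_map
  have := (hY.hasGaussianLaw I).isGaussian_map
  apply IsGaussian.ext
  · rw [integral_map (by fun_prop) (by fun_prop), integral_map hXm (by fun_prop),
      integral_map (by fun_prop) (by fun_prop), integral_map hYm (by fun_prop)]
    simp only [id_eq]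
    rw [ContinuousLinearEquiv.integral_comp_comm, ContinuousLinearEquiv.integral_comp_comm]
    congr 1
    ext i
    exact (eval_integral (f := fun ω (i : I) ↦ X i ω) (fun i ↦ (hX.hasGaussianLaw_eval _).integrable)
      i).trans ((hm i).trans (eval_integral (f := fun ω (i : I) ↦ Y i ω)
        (fun i ↦ (hY.hasGaussianLaw_eval _).integrable) i).symm)
  · rw [← ContinuousLinearMap.toBilinForm_inj]
    refine LinearMap.BilinForm.ext_of_isSymm isPosSemidef_covarianceBilin.isSymm
      isPosSemidef_covarianceBilin.isSymm fun x ↦ ?_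
    simp only [ContinuousLinearMap.toBilinForm_apply]
    rw [PiLp.coe_symm_continuousLinearEquiv, covarianceBilin_apply_pi, covarianceBilin_apply_pi]
    · congrm ∑ i, ∑ j, _ * ?_
      rw [covariance_map (measurable_pi_apply i).aestronglyMeasurable
          (measurable_pi_apply j).aestronglyMeasurable hXm,
        covariance_map (measurable_pi_apply i).aestronglyMeasurable
          (measurable_pi_apply j).aestronglyMeasurable hYm]
      exact hc i j
    · exact fun i ↦ ((hY.hasGaussianLaw I).isGaussian_map.hasGaussianLaw_id.eval i).memLp_two
    · exact fun i ↦ ((hX.hasGaussianLaw I).isGaussian_map.hasGaussianLaw_id.eval i).memLp_two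

/-- A process is Gaussian if all finite linear combinations of its values are. -/
theorem isGaussianProcess_of_hasGaussianLaw_sum {X : T → Ω → ℝ}
    (h : ∀ (I : Finset T) (c : T → ℝ), HasGaussianLaw (fun ω ↦ ∑ i ∈ I, c i * X i ω) P) :
    IsGaussianProcess X P where
  hasGaussianLaw I := by
    classical
    have hm : ∀ t, AEMeasurable (X t) P := fun t ↦ by
      simpa using (h {t} fun _ ↦ 1).aemeasurable
    have hXm : AEMeasurable (fun ω ↦ I.restrict (X · ω)) P :=
      aemeasurable_pi_lambda _ fun _ ↦ hm _
    refine ⟨⟨fun L ↦ ?_⟩⟩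
    -- A functional `L` on `ℝ^I` is the linear combination with coefficients `L(eᵢ)`, extended by
    -- `0` outside `I`.
    have hL : (fun ω ↦ ∑ i ∈ I, (if hi : i ∈ I then L (Pi.single ⟨i, hi⟩ 1) else 0) * X i ω)
        = L ∘ fun ω ↦ I.restrict (X · ω) := by
      ext ω
      have := LinearMap.pi_apply_eq_sum_univ L.toLinearMap (I.restrict (X · ω))
      rw [ContinuousLinearMap.coe_coe] at this
      rw [Function.comp_apply, this, ← Finset.sum_coe_sort I]
      refine Finset.sum_congr rfl fun i _ ↦ ?_
      rw [dif_pos i.2, mul_comm, smul_eq_mul]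
      congr 2
      ext j
      simp [Pi.single_apply, eq_comm]
    have hG := h I fun i ↦ if hi : i ∈ I then L (Pi.single ⟨i, hi⟩ 1) else 0
    rw [hL] at hG
    rw [AEMeasurable.map_map_of_aemeasurable (by fun_prop) hXm, hG.map_eq_gaussianReal,
      integral_map hXm (by fun_prop), variance_map (by fun_prop) hXm]
    rfl

/-- Integrals of Lipschitz functions are continuous on `L²` of a probability space. -/
theorem LipschitzWith.continuous_integral_Lp {F : Type*} [NormedAddCommGroup F] [NormedSpace ℝ F]
    [SecondCountableTopology F]
    [IsProbabilityMeasure P] {K : ℝ≥0} {g : ℝ → F} (hg : LipschitzWith K g) :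
    Continuous fun Z : Lp ℝ 2 P ↦ ∫ ω, g (Z ω) ∂P := by
  have hint : ∀ Z : Lp ℝ 2 P, Integrable Z P := fun Z ↦ (Lp.memLp Z).integrable (by norm_num)
  have hgi : ∀ Z : Lp ℝ 2 P, Integrable (fun ω ↦ g (Z ω)) P := fun Z ↦ by
    refine Integrable.mono' (((hint Z).norm.const_mul K).add (integrable_const ‖g 0‖))
      (hg.continuous.comp_aestronglyMeasurable (Lp.aestronglyMeasurable Z)) (ae_of_all _ fun ω ↦ ?_)
    have := hg.dist_le_mul (Z ω) 0
    rw [dist_eq_norm, dist_zero_right] at this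
    have h2 := norm_le_norm_add_norm_sub' (g (Z ω)) (g 0)
    simp only [Pi.add_apply]
    linarith
  refine (LipschitzWith.of_dist_le_mul (K := K) fun Z Z' ↦ ?_).continuous
  rw [dist_eq_norm, ← integral_sub (hgi Z) (hgi Z')]
  calc ‖∫ ω, (g (Z ω) - g (Z' ω)) ∂P‖ ≤ ∫ ω, ‖g (Z ω) - g (Z' ω)‖ ∂P := norm_integral_le_integral_norm _
    _ ≤ ∫ ω, K * ‖Z ω - Z' ω‖ ∂P := by
      refine integral_mono ((hgi Z).sub (hgi Z')).norm
        (((hint Z).sub (hint Z')).norm.const_mul _) fun ω ↦ ?_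
      simpa [dist_eq_norm] using hg.dist_le_mul (Z ω) (Z' ω)
    _ = K * ∫ ω, ‖(Z - Z' : Lp ℝ 2 P) ω‖ ∂P := by
      rw [integral_const_mul]
      congr 1
      refine integral_congr_ae ?_
      filter_upwards [Lp.coeFn_sub Z Z'] with ω hω
      rw [hω, Pi.sub_apply]
    _ ≤ K * dist Z Z' := by
      gcongr
      rw [dist_eq_norm, integral_norm_eq_lintegral_enorm (Lp.aestronglyMeasurable _),
        ← eLpNorm_one_eq_lintegral_enorm, Lp.norm_def]
      exact ENNReal.toReal_mono (Lp.eLpNorm_ne_top _)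
        (eLpNorm_le_eLpNorm_of_exponent_le (by norm_num) (Lp.aestronglyMeasurable _))

/-- `L²` limits of Gaussian random variables are Gaussian. -/
theorem isClosed_setOf_hasGaussianLaw [IsProbabilityMeasure P] :
    IsClosed {Z : Lp ℝ 2 P | HasGaussianLaw Z P} := by
  -- Gaussianity is an identity of characteristic functions. For each `u` both sides are continuous
  -- in `Z`: the left because `x ↦ exp(iux)` is Lipschitz, the right because mean and norm are
  -- continuous.
  have key : ∀ Z : Lp ℝ 2 P, HasGaussianLaw Z P ↔ ∀ u : ℝ,
      ∫ ω, Complex.exp (u * (Z ω : ℝ) * Complex.I) ∂P = Complex.exp ((u * ∫ ω, Z ω ∂P : ℝ) * Complex.I -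
        (u ^ 2 * (‖Z‖ ^ 2 - (∫ ω, Z ω ∂P) ^ 2) : ℝ) / 2) := fun Z ↦ by
    rw [hasGaussianLaw_iff_charFun_map_eq (Lp.aestronglyMeasurable Z).aemeasurable]
    refine forall_congr' fun u ↦ ?_
    have h1 : Var[Z; P] = ‖Z‖ ^ 2 - (∫ ω, Z ω ∂P) ^ 2 := by
      rw [variance_eq_sub (Lp.memLp Z), ← real_inner_self_eq_norm_sq, L2.inner_def]
      simp [pow_two]
    rw [charFun_apply_real, integral_map (Lp.aestronglyMeasurable Z).aemeasurable (by fun_prop), ← h1]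
    have h2 : (fun ω ↦ inner ℝ u (Z ω)) = fun ω ↦ u * Z ω := by
      ext ω; simp [mul_comm]
    rw [h2, integral_const_mul, variance_const_mul]
  simp_rw [key]
  rw [Set.ofPred_forall]
  refine isClosed_iInter fun u ↦ isClosed_eq ?_ ?_
  · have : LipschitzWith ‖u‖₊ fun x : ℝ ↦ Complex.exp (u * x * Complex.I) := by
      refine lipschitzWith_of_nnnorm_deriv_le (𝕜 := ℝ) (by fun_prop) fun x ↦ ?_
      have hd : HasDerivAt (fun x : ℝ ↦ Complex.exp (u * x * Complex.I))
          (Complex.exp (u * x * Complex.I) * (u * Complex.I)) x := by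
        have := ((Complex.ofRealCLM.hasDerivAt (x := x)).const_mul (u : ℂ)).mul_const Complex.I
        simpa using this.cexp
      rw [hd.deriv, ← NNReal.coe_le_coe]
      have : ‖Complex.exp (u * x * Complex.I)‖ = 1 := by
        exact_mod_cast Complex.norm_exp_ofReal_mul_I (u * x)
      simp [this]
    exact this.continuous_integral_Lp
  · have : Continuous fun Z : Lp ℝ 2 P ↦ ∫ ω, Z ω ∂P := LipschitzWith.id.continuous_integral_Lp
    fun_prop

end GaussianProcesses

/-! ### Isonormal Gaussian processes. -/

/-- Every real Hilbert space carries an isonormal Gaussian process. -/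
theorem exists_isonormalProcess.{u} {H : Type u} [NormedAddCommGroup H] [InnerProductSpace ℝ H]
    [CompleteSpace H] :
    ∃ (Ω : Type u) (_ : MeasurableSpace Ω) (P : Measure Ω) (W : H → Ω → ℝ),
      IsGaussianProcess W P ∧ (∀ g, ∫ ω, W g ω ∂P = 0) ∧ ∀ f g, cov[W f, W g; P] = inner ℝ f g := by
  obtain ⟨w, e, -⟩ := exists_hilbertBasis ℝ H
  obtain ⟨Ω, mΩ, P, ξ, hξm, hξl, hξi, hP⟩ := exists_iid w (gaussianReal 0 1)
  have hg : ∀ i, HasGaussianLaw (ξ i) P := fun i ↦ (hξl i).hasGaussianLaw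
  have hL : ∀ i, MemLp (ξ i) 2 P := fun i ↦ (hg i).memLp_two
  have hmean : ∀ i, ∫ ω, ξ i ω ∂P = 0 := fun i ↦ by
    rw [(hξl i).integral_eq, integral_id_gaussianReal]
  have horth : Orthonormal ℝ fun i ↦ (hL i).toLp (ξ i) := by
    classical
    rw [orthonormal_iff_ite]
    intro i j
    have h1 : inner ℝ ((hL i).toLp (ξ i)) ((hL j).toLp (ξ j)) = cov[ξ i, ξ j; P] := by
      rw [covariance_eq_sub (hL i) (hL j), hmean i, L2.inner_def, zero_mul, sub_zero]
      refine integral_congr_ae ?_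
      filter_upwards [(hL i).coeFn_toLp, (hL j).coeFn_toLp] with ω h1 h2
      simp [h1, h2, mul_comm]
    rw [h1]
    split_ifs with hij
    · subst hij
      rw [covariance_self (hξm i).aemeasurable, (hξl i).variance_eq, variance_id_gaussianReal]
      simp
    · exact (hξi.indepFun hij).covariance_eq_zero (hL i) (hL j)
  -- Independent standard normals are orthonormal in `L²(P)`, so sending the basis to them extends
  -- to an isometry, and this isometry is the process.
  let U : H →ₗᵢ[ℝ] Lp ℝ 2 P :=
    horth.orthogonalFamily.linearIsometry.comp e.repr.toLinearIsometry
  have hU : ∀ f, HasGaussianLaw (U f) P ∧ ∫ ω, U f ω ∂P = 0 := fun f ↦ by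
    have hs := horth.orthogonalFamily.hasSum_linearIsometry (e.repr f)
    have hcl : IsClosed {Z : Lp ℝ 2 P | HasGaussianLaw Z P ∧ ∫ ω, Z ω ∂P = 0} :=
      isClosed_setOf_hasGaussianLaw.inter
        (isClosed_eq LipschitzWith.id.continuous_integral_Lp continuous_const)
    refine hcl.mem_of_tendsto hs (Eventually.of_forall fun I ↦ ?_)
    have hsum : (fun ω ↦ ∑ i ∈ I, e.repr f i * ξ i ω) =ᵐ[P]
        ↑(∑ i ∈ I, (LinearIsometry.toSpanSingleton ℝ (Lp ℝ 2 P) (horth.1 i)) (e.repr f i)) := by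
      have h1 : ∀ᵐ ω ∂P, ∀ i ∈ I, ((e.repr f i) • (hL i).toLp (ξ i)) ω = e.repr f i * ξ i ω := by
        rw [eventually_all_finset]
        intro i _
        filter_upwards [Lp.coeFn_smul (e.repr f i) ((hL i).toLp (ξ i)), (hL i).coeFn_toLp]
          with ω h1 h2
        rw [h1, Pi.smul_apply, h2, smul_eq_mul]
      filter_upwards [h1, Lp.coeFn_finsetSum I fun i ↦ (e.repr f i) • (hL i).toLp (ξ i)] with ω h1 h2
      simp only [LinearIsometry.toSpanSingleton_apply]
      rw [h2, Finset.sum_apply]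
      exact (Finset.sum_congr rfl h1).symm
    refine ⟨HasGaussianLaw.congr ?_ hsum, ?_⟩
    · have h2 := iIndepFun.hasGaussianLaw (X := fun i : I ↦ ξ i) (fun i ↦ hg i)
        (hξi.precomp Subtype.val_injective)
      have h3 := h2.map (∑ i : I, (e.repr f i) • ContinuousLinearMap.proj (R := ℝ) i)
      refine h3.congr (ae_of_all _ fun ω ↦ ?_)
      rw [Function.comp_apply, sum_apply]
      exact Finset.sum_coe_sort I fun i ↦ e.repr f i * ξ i ω
    · rw [← integral_congr_ae hsum, integral_finsetSum _ fun i _ ↦ ((hg i).integrable).const_mul _]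
      simp [integral_const_mul, hmean]
  refine ⟨Ω, mΩ, P, fun f ↦ U f, isGaussianProcess_of_hasGaussianLaw_sum fun I c ↦ ?_,
    fun g ↦ (hU g).2, fun f g ↦ ?_⟩
  · refine (hU (∑ i ∈ I, c i • i)).1.congr ?_
    rw [map_sum]
    have h1 : ∀ᵐ ω ∂P, ∀ i ∈ I, (U (c i • i)) ω = c i * U i ω := by
      rw [eventually_all_finset]
      intro i _
      rw [map_smul]
      filter_upwards [Lp.coeFn_smul (c i) (U i)] with ω h1
      rw [h1, Pi.smul_apply, smul_eq_mul]
    filter_upwards [h1, Lp.coeFn_finsetSum I fun i ↦ U (c i • i)] with ω h1 h2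
    rw [h2, Finset.sum_apply]
    exact Finset.sum_congr rfl h1
  · rw [covariance_eq_sub (Lp.memLp _) (Lp.memLp _), (hU f).2, zero_mul, sub_zero, ← U.inner_map_map,
      L2.inner_def]
    exact integral_congr_ae (ae_of_all _ fun ω ↦ mul_comm _ _)

/-! ### Continuous extension of a path from the dyadic numbers. -/

section KolmogorovChentsov

/-- The largest dyadic number of level `n` below `t`. -/
noncomputable def dyadicFloor (n : ℕ) (t : ℝ≥0) : ℝ≥0 := ⌊2 ^ n * t⌋₊ / 2 ^ n

theorem edist_dyadicFloor_le (n : ℕ) (t : ℝ≥0) :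
    edist (dyadicFloor n t) t ≤ ((2⁻¹ ^ n : ℝ≥0) : ℝ≥0∞) := by
  have h2 : (0 : ℝ) < 2 ^ n := by positivity
  have h1 := Nat.floor_le (zero_le : 0 ≤ 2 ^ n * t)
  have h3 := Nat.lt_floor_add_one (2 ^ n * t)
  rw [edist_nndist, ENNReal.coe_le_coe, ← NNReal.coe_le_coe, coe_nndist, NNReal.dist_eq]
  rw [← NNReal.coe_le_coe] at h1
  rw [← NNReal.coe_lt_coe] at h3
  simp only [dyadicFloor]
  push_cast at h1 h3 ⊢
  have e : (2 ^ n : ℝ) * (2⁻¹ : ℝ) ^ n = 1 := by rw [← mul_pow]; norm_num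
  rw [abs_le]
  constructor
  · rw [neg_le_sub_iff_le_add, ← mul_le_mul_iff_right₀ h2, mul_add, e, mul_div_cancel₀ _ h2.ne']
    linarith
  · rw [sub_le_iff_le_add, ← mul_le_mul_iff_right₀ h2, mul_add, e, mul_div_cancel₀ _ h2.ne']
    linarith

/-- If the dyadic increments of a path decay geometrically, locally uniformly, then the path
extends continuously from the dyadic numbers. -/
theorem exists_continuous_tendsto_dyadicFloor {x : ℝ≥0 → ℝ} {ρ : ℝ} (hρ : 0 < ρ) (hρ1 : ρ < 1)
    (hx : ∀ᶠ n : ℕ in atTop, ∀ k < n * 2 ^ n, dist (x ((k + 1 : ℕ) / 2 ^ n)) (x (k / 2 ^ n)) ≤ ρ ^ n) :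
    ∃ y : ℝ≥0 → ℝ, Continuous y ∧ ∀ t, Tendsto (fun n ↦ x (dyadicFloor n t)) atTop (𝓝 (y t)) := by
  obtain ⟨n₀, hn₀⟩ := eventually_atTop.1 hx
  have hfl : ∀ (N n : ℕ) (t : ℝ≥0), t ≤ N → N < n → ⌊2 ^ n * t⌋₊ < n * 2 ^ n := by
    intro N n t ht hn
    rw [Nat.floor_lt zero_le]
    push_cast
    rw [mul_comm]
    have : t < n := ht.trans_lt (by exact_mod_cast hn)
    gcongr
  have hstep : ∀ (N n : ℕ) (t : ℝ≥0), t ≤ N → n₀ ≤ n → N < n →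
      dist (x (dyadicFloor n t)) (x (dyadicFloor (n + 1) t)) ≤ ρ * ρ ^ n := by
    intro N n t ht hn hN
    have h1 : ⌊2 ^ n * t⌋₊ = ⌊2 ^ (n + 1) * t⌋₊ / 2 := by
      rw [← Nat.floor_div_ofNat, pow_succ]
      congr 1
      rw [eq_div_iff (by norm_num)]
      ring
    have h2 := hfl N (n + 1) t ht (by lia)
    set m := ⌊2 ^ (n + 1) * t⌋₊ with hm
    have h3 : dyadicFloor n t = (2 * (m / 2) : ℕ) / 2 ^ (n + 1) := by
      rw [dyadicFloor, h1, pow_succ]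
      push_cast
      field_simp
    have h4 : dyadicFloor (n + 1) t = m / 2 ^ (n + 1) := rfl
    rw [h3, h4]
    -- For even `m` the floors at levels `n` and `n + 1` coincide; for odd `m` they are neighbours
    -- at level `n + 1`.
    rcases Nat.mod_two_eq_zero_or_one m with h | h
    · have : 2 * (m / 2) = m := by lia
      rw [this, dist_self]
      positivity
    · have : m = 2 * (m / 2) + 1 := by lia
      rw [dist_comm, ← pow_succ']
      conv_lhs => rw [show ((m : ℕ) : ℝ≥0) = ((2 * (m / 2) + 1 : ℕ) : ℝ≥0) by exact_mod_cast this]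
      exact hn₀ (n + 1) (by lia) _ (by lia)
  have hlim : ∀ t, ∃ y, Tendsto (fun n ↦ x (dyadicFloor n t)) atTop (𝓝 y) := by
    intro t
    obtain ⟨N, hN⟩ := exists_nat_ge t
    have := cauchySeq_of_le_geometric (f := fun n ↦ x (dyadicFloor (n + (n₀ + N + 1)) t)) ρ
      (ρ * ρ ^ (n₀ + N + 1)) hρ1 fun n ↦ by
        have := hstep N (n + (n₀ + N + 1)) t hN (by lia) (by lia)
        rw [pow_add] at this
        rw [show n + 1 + (n₀ + N + 1) = n + (n₀ + N + 1) + 1 by ring]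
        exact this.trans_eq (by ring)
    obtain ⟨y, hy⟩ := cauchySeq_tendsto_of_complete this
    exact ⟨y, (tendsto_add_atTop_iff_nat _).1 hy⟩
  choose y hy using hlim
  refine ⟨y, ?_, hy⟩
  have hyb : ∀ (N n : ℕ) (t : ℝ≥0), t ≤ N → n₀ ≤ n → N < n →
      dist (x (dyadicFloor n t)) (y t) ≤ (ρ / (1 - ρ)) * ρ ^ n := by
    intro N n t ht hn hN
    have := dist_le_of_le_geometric_of_tendsto₀ (f := fun k ↦ x (dyadicFloor (n + k) t)) ρ
      (ρ * ρ ^ n) hρ1 (fun k ↦ by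
        have := hstep N (n + k) t ht (by lia) (by lia)
        rw [pow_add] at this
        exact this.trans_eq (by ring)) (a := y t) (by
          have := (tendsto_add_atTop_iff_nat n).2 (hy t)
          simpa only [add_comm] using this)
    exact this.trans_eq (by ring)
  rw [Metric.continuous_iff']
  intro t ε hε
  obtain ⟨N, hN⟩ := exists_nat_ge (t + 1)
  have hlim0 : Tendsto (fun n : ℕ ↦ (ρ / (1 - ρ) + ρ / (1 - ρ) + 1) * ρ ^ n) atTop (𝓝 0) := by
    simpa using (tendsto_pow_atTop_nhds_zero_of_lt_one hρ.le hρ1).const_mul _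
  obtain ⟨n, hn, hn1⟩ :=
    ((hlim0.eventually (gt_mem_nhds hε)).and (eventually_ge_atTop (n₀ + N + 1))).exists
  have htN : t ≤ N := le_trans (by simp) hN
  filter_upwards [Metric.ball_mem_nhds t (show (0 : ℝ) < 2⁻¹ ^ n by positivity),
    gt_mem_nhds (show t < t + 1 by simp)] with s hs hs1
  have hsN : s ≤ N := hs1.le.trans hN
  -- Points closer than `2⁻ⁿ` have level-`n` floors that are equal or adjacent, so one increment
  -- bound suffices.
  have hmid : dist (x (dyadicFloor n s)) (x (dyadicFloor n t)) ≤ ρ ^ n := by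
    have aux : ∀ u v : ℝ≥0, u ≤ v → v ≤ N → dist u v < 2⁻¹ ^ n →
        dist (x (dyadicFloor n v)) (x (dyadicFloor n u)) ≤ ρ ^ n := by
      intro u v huv hv hd
      have h1 : ⌊2 ^ n * u⌋₊ ≤ ⌊2 ^ n * v⌋₊ := Nat.floor_mono (by gcongr)
      have h2 : ⌊2 ^ n * v⌋₊ ≤ ⌊2 ^ n * u⌋₊ + 1 := by
        rw [← Nat.floor_add_one zero_le]
        refine Nat.floor_mono ?_
        rw [← NNReal.coe_le_coe]
        push_cast
        have e : (2 ^ n : ℝ) * (2⁻¹ : ℝ) ^ n = 1 := by rw [← mul_pow]; norm_num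
        rw [NNReal.dist_eq, abs_lt] at hd
        have h3 : (v : ℝ) ≤ u + 2⁻¹ ^ n := by linarith [hd.1]
        calc (2 : ℝ) ^ n * v ≤ 2 ^ n * (u + 2⁻¹ ^ n) := by gcongr
          _ = _ := by rw [mul_add, e]
      have h3 := hfl N n u (huv.trans hv) (by lia)
      unfold dyadicFloor
      rcases h1.eq_or_lt with h | h
      · rw [h, dist_self]; positivity
      · rw [show ⌊2 ^ n * v⌋₊ = ⌊2 ^ n * u⌋₊ + 1 by lia]
        exact hn₀ n (by lia) _ h3
    rcases le_total s t with h | h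
    · rw [dist_comm]
      exact aux s t h htN hs
    · exact aux t s h hsN (by rw [dist_comm]; exact hs)
  calc dist (y s) (y t)
      ≤ dist (y s) (x (dyadicFloor n s)) + dist (x (dyadicFloor n s)) (x (dyadicFloor n t))
        + dist (x (dyadicFloor n t)) (y t) := dist_triangle4 _ _ _ _
    _ ≤ (ρ / (1 - ρ)) * ρ ^ n + ρ ^ n + (ρ / (1 - ρ)) * ρ ^ n := by
      gcongr
      · rw [dist_comm]; exact hyb N n s hsN (by lia) (by lia)
      · exact hyb N n t htN (by lia) (by lia)
    _ = (ρ / (1 - ρ) + ρ / (1 - ρ) + 1) * ρ ^ n := by ring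
    _ < ε := hn

end KolmogorovChentsov

/-! ### The Kolmogorov–Chentsov theorem from moment bounds. -/

section KolmogorovChentsov

variable {Ω : Type*} [MeasurableSpace Ω] {P : Measure Ω}

/-- The expected sum of `p`-th powers of the errors is at most `M ∑ 2^(-nq) < ∞`, so almost surely
the errors are summable in this sense and tend to zero. -/
theorem ae_tendsto_dyadicFloor {X : ℝ≥0 → Ω → ℝ} (hX : ∀ t, Measurable (X t))
    {p q : ℝ} (hp : 0 < p) (hq : 0 < q) {M : ℝ≥0}
    (h : ∀ s t, ∫⁻ ω, edist (X s ω) (X t ω) ^ p ∂P ≤ M * edist s t ^ q) (t : ℝ≥0) :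
    ∀ᵐ ω ∂P, Tendsto (fun n ↦ X (dyadicFloor n t) ω) atTop (𝓝 (X t ω)) := by
  have hm : ∀ n, Measurable fun ω ↦ edist (X (dyadicFloor n t) ω) (X t ω) ^ p := fun n ↦
    ((hX _).edist (hX _)).pow_const _
  have hr : (2⁻¹ : ℝ≥0) ^ q < 1 := NNReal.rpow_lt_one (by norm_num) hq
  have hsum : ∫⁻ ω, ∑' n, edist (X (dyadicFloor n t) ω) (X t ω) ^ p ∂P ≠ ∞ := by
    rw [lintegral_tsum fun n ↦ (hm n).aemeasurable]
    refine ne_top_of_le_ne_top ?_ (ENNReal.tsum_le_tsum (g := fun n ↦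
      (((M * ((2⁻¹ : ℝ≥0) ^ q) ^ n : ℝ≥0)) : ℝ≥0∞)) fun n ↦ ?_)
    · rw [ENNReal.tsum_coe_ne_top_iff_summable]
      exact (NNReal.summable_geometric hr).mul_left _
    · refine (h _ _).trans ?_
      rw [ENNReal.coe_mul]
      gcongr
      calc edist (dyadicFloor n t) t ^ q ≤ ((2⁻¹ ^ n : ℝ≥0) : ℝ≥0∞) ^ q :=
            ENNReal.rpow_le_rpow (edist_dyadicFloor_le n t) hq.le
        _ = _ := by
          rw [← ENNReal.coe_rpow_of_nonneg _ hq.le, ← NNReal.rpow_natCast, ← NNReal.rpow_mul,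
            mul_comm, NNReal.rpow_mul, NNReal.rpow_natCast]
  filter_upwards [ae_lt_top' (AEMeasurable.tsum fun n ↦ (hm n).aemeasurable) hsum] with ω hω
  have h0 := ENNReal.tendsto_atTop_zero_of_tsum_ne_top hω.ne
  rw [tendsto_iff_edist_tendsto_0]
  have h1 := (ENNReal.continuous_rpow_const (y := p⁻¹)).tendsto 0 |>.comp h0
  rw [ENNReal.zero_rpow_of_pos (inv_pos.2 hp)] at h1
  refine h1.congr fun n ↦ ?_
  rw [Function.comp_apply, ENNReal.rpow_rpow_inv hp.ne']

/-- A Borel–Cantelli argument: the weighted sums `F n` of `p`-th powers of increments over `[0, n]`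
have summable expectations, so almost surely they are eventually at most `1`, which bounds every
single increment. -/
theorem ae_eventually_dyadic_increments_le {X : ℝ≥0 → Ω → ℝ} (hX : ∀ t, Measurable (X t))
    {p q : ℝ} (hp : 0 < p) (hq : 1 < q) {M : ℝ≥0}
    (h : ∀ s t, ∫⁻ ω, edist (X s ω) (X t ω) ^ p ∂P ≤ M * edist s t ^ q) :
    ∃ ρ : ℝ, 0 < ρ ∧ ρ < 1 ∧ ∃ S : Set Ω, MeasurableSet S ∧ (∀ᵐ ω ∂P, ω ∈ S) ∧
      ∀ ω ∈ S, ∀ᶠ n : ℕ in atTop, ∀ k < n * 2 ^ n,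
        dist (X ((k + 1 : ℕ) / 2 ^ n) ω) (X (k / 2 ^ n) ω) ≤ ρ ^ n := by
  -- Half of the surplus exponent `q - 1` is spent on the weight `cⁿ`. Since `2^(1-q) = c^(-2)`, the
  -- expectation of `F n` is at most `M n c^(-n)`, and `F n ≤ 1` gives increments at most `c^(-n/p)
  -- = ρⁿ`.
  set c : ℝ≥0 := 2 ^ ((q - 1) / 2) with hc
  have hc1 : 1 < c := NNReal.one_lt_rpow (by norm_num) (by linarith)
  have hc0 : 0 < c := zero_lt_one.trans hc1
  set ρ : ℝ≥0 := c⁻¹ ^ p⁻¹ with hρ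
  have hρ1 : ρ < 1 := NNReal.rpow_lt_one (inv_lt_one_of_one_lt₀ hc1) (inv_pos.2 hp)
  have hρ0 : 0 < ρ := NNReal.rpow_pos (inv_pos.2 hc0)
  set r : ℝ≥0 := c⁻¹ with hr
  have hr1 : r < 1 := inv_lt_one_of_one_lt₀ hc1
  have hrc : r = 2 * 2⁻¹ ^ q * c := by
    rw [hr, hc, ← NNReal.rpow_neg, NNReal.inv_rpow, ← NNReal.rpow_neg]
    nth_rewrite 2 [← NNReal.rpow_one 2]
    rw [← NNReal.rpow_add (by norm_num), ← NNReal.rpow_add (by norm_num)]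
    congr 1
    ring
  set F : ℕ → Ω → ℝ≥0∞ := fun n ω ↦ ∑ k ∈ Finset.range (n * 2 ^ n),
    ((c ^ n : ℝ≥0) : ℝ≥0∞) * edist (X ((k + 1 : ℕ) / 2 ^ n) ω) (X (k / 2 ^ n) ω) ^ p with hF
  have hm : ∀ n k : ℕ, Measurable fun ω ↦
      ((c ^ n : ℝ≥0) : ℝ≥0∞) * edist (X ((k + 1 : ℕ) / 2 ^ n) ω) (X (k / 2 ^ n) ω) ^ p :=
    fun n k ↦ (((hX _).edist (hX _)).pow_const _).const_mul _
  have hFm : ∀ n, Measurable (F n) := fun n ↦ Finset.measurable_fun_sum _ fun k _ ↦ hm n k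
  have hdist : ∀ n k : ℕ, edist (((k + 1 : ℕ) / 2 ^ n : ℝ≥0)) (k / 2 ^ n) =
      ((2⁻¹ ^ n : ℝ≥0) : ℝ≥0∞) := by
    intro n k
    rw [edist_nndist, ENNReal.coe_inj, ← NNReal.coe_inj, coe_nndist, NNReal.dist_eq]
    push_cast
    rw [← sub_div, add_sub_cancel_left, abs_of_pos (by positivity), inv_pow, one_div]
  have hsum : ∫⁻ ω, ∑' n, F n ω ∂P ≠ ∞ := by
    rw [lintegral_tsum fun n ↦ (hFm n).aemeasurable]
    refine ne_top_of_le_ne_top ?_ (ENNReal.tsum_le_tsum (g := fun n : ℕ ↦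
      (((M * (n * r ^ n) : ℝ≥0)) : ℝ≥0∞)) fun n ↦ ?_)
    · rw [ENNReal.tsum_coe_ne_top_iff_summable]
      refine Summable.mul_left _ ?_
      rw [← NNReal.summable_coe]
      have := summable_pow_mul_geometric_of_norm_lt_one 1 (r := (r : ℝ))
        (by rw [NNReal.norm_eq]; exact_mod_cast hr1)
      simpa using this
    · rw [hF, lintegral_finsetSum _ fun k _ ↦ hm n k]
      calc ∑ k ∈ Finset.range (n * 2 ^ n), ∫⁻ ω, ((c ^ n : ℝ≥0) : ℝ≥0∞) *
            edist (X ((k + 1 : ℕ) / 2 ^ n) ω) (X (k / 2 ^ n) ω) ^ p ∂P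
          ≤ ∑ k ∈ Finset.range (n * 2 ^ n), (((c ^ n * (M * (2⁻¹ ^ n) ^ q) : ℝ≥0)) : ℝ≥0∞) := by
            refine Finset.sum_le_sum fun k _ ↦ ?_
            rw [lintegral_const_mul _ (((hX _).edist (hX _)).pow_const _), ENNReal.coe_mul]
            gcongr
            refine (h _ _).trans_eq ?_
            rw [hdist, ENNReal.coe_mul, ENNReal.coe_rpow_of_nonneg _ (by linarith)]
        _ = _ := by
          rw [Finset.sum_const, Finset.card_range, nsmul_eq_mul, ← ENNReal.coe_natCast,
            ← ENNReal.coe_mul, ENNReal.coe_inj, hrc, ← NNReal.rpow_natCast 2⁻¹, ← NNReal.rpow_mul,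
            mul_comm (n : ℝ) q, NNReal.rpow_mul, NNReal.rpow_natCast]
          push_cast
          ring
  refine ⟨ρ, by exact_mod_cast hρ0, by exact_mod_cast hρ1, {ω | ∑' n, F n ω < ∞},
    measurableSet_lt (Measurable.tsum hFm) measurable_const,
    ae_lt_top' (AEMeasurable.tsum fun n ↦ (hFm n).aemeasurable) hsum, fun ω hω ↦ ?_⟩
  have h0 := ENNReal.tendsto_atTop_zero_of_tsum_ne_top (ne_of_lt hω)
  filter_upwards [h0.eventually (ge_mem_nhds (show (0 : ℝ≥0∞) < 1 by simp))] with n hn k hk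
  have h1 := (Finset.single_le_sum (f := fun k : ℕ ↦ ((c ^ n : ℝ≥0) : ℝ≥0∞) *
    edist (X ((k + 1 : ℕ) / 2 ^ n) ω) (X (k / 2 ^ n) ω) ^ p) (fun _ _ ↦ zero_le)
    (Finset.mem_range.2 hk)).trans hn
  rw [edist_nndist, ← ENNReal.coe_rpow_of_nonneg _ hp.le, ← ENNReal.coe_mul,
    ← ENNReal.coe_one, ENNReal.coe_le_coe] at h1
  rw [← coe_nndist, ← NNReal.coe_pow, NNReal.coe_le_coe, hρ,
    ← NNReal.rpow_natCast (r ^ p⁻¹), ← NNReal.rpow_mul, mul_comm, NNReal.rpow_mul, NNReal.rpow_natCast,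
    NNReal.le_rpow_inv_iff hp, hr, inv_pow, ← one_div, le_div_iff₀ (pow_pos hc0 n), mul_comm]
  exact h1

/-- **Kolmogorov–Chentsov**: a process on `[0, ∞)` whose increments have moments of order `p`
bounded by a power `q > 1` of their length has a continuous version. -/
theorem exists_isContinuousVersion_of_lintegral_edist_le {X : ℝ≥0 → Ω → ℝ}
    (hX : ∀ t, AEMeasurable (X t) P) {p q : ℝ} (hp : 0 < p) (hq : 1 < q) {M : ℝ≥0}
    (h : ∀ s t, ∫⁻ ω, edist (X s ω) (X t ω) ^ p ∂P ≤ M * edist s t ^ q) :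
    ∃ Y : ℝ≥0 → Ω → ℝ, IsContinuousVersion Y X P := by
  classical
  have hZm : ∀ t, Measurable ((hX t).mk (X t)) := fun t ↦ (hX t).measurable_mk
  have hZ : ∀ s t, ∫⁻ ω, edist ((hX s).mk (X s) ω) ((hX t).mk (X t) ω) ^ p ∂P
      ≤ M * edist s t ^ q := fun s t ↦ by
    refine le_trans (le_of_eq (lintegral_congr_ae ?_)) (h s t)
    filter_upwards [(hX s).ae_eq_mk, (hX t).ae_eq_mk] with ω h1 h2
    rw [h1, h2]
  obtain ⟨ρ, hρ0, hρ1, S, hSm, hS, hS'⟩ := ae_eventually_dyadic_increments_le hZm hp hq hZ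
  -- Replacing the process by zero off `S` makes the limit exist for every `ω`, hence continuous
  -- everywhere and measurable in `ω`.
  have hex : ∀ ω, ∃ y : ℝ≥0 → ℝ, Continuous y ∧ ∀ t, Tendsto
      (fun n ↦ S.indicator ((hX (dyadicFloor n t)).mk (X (dyadicFloor n t))) ω) atTop (𝓝 (y t)) := by
    intro ω
    by_cases hω : ω ∈ S
    · simp only [Set.indicator_of_mem hω]
      exact exists_continuous_tendsto_dyadicFloor (x := fun t ↦ (hX t).mk (X t) ω) hρ0 hρ1 (hS' ω hω)
    · simp only [Set.indicator_of_notMem hω]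
      exact ⟨fun _ ↦ 0, continuous_const, fun t ↦ tendsto_const_nhds⟩
  choose y hyc hyt using hex
  refine ⟨fun t ω ↦ y ω t, fun t ↦ ?_, hyc, fun t ↦ ?_⟩
  · exact measurable_of_tendsto_metrizable (fun n ↦ (hZm (dyadicFloor n t)).indicator hSm)
      (tendsto_pi_nhds.2 fun ω ↦ hyt ω t)
  · filter_upwards [hS, ae_tendsto_dyadicFloor hZm hp (by linarith) hZ t, (hX t).ae_eq_mk]
      with ω h1 h2 h3
    rw [h3]
    have := hyt ω t
    simp only [Set.indicator_of_mem h1] at this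
    exact tendsto_nhds_unique this h2

end KolmogorovChentsov

/-! ### Gaussian moments and continuity of Gaussian processes. -/

section GaussianContinuity

variable {Ω : Type*} [MeasurableSpace Ω] {P : Measure Ω}

theorem lintegral_enorm_rpow_gaussianReal {p : ℝ} (hp : 0 ≤ p) (v : ℝ≥0) :
    ∫⁻ x, ‖x‖ₑ ^ p ∂gaussianReal 0 v
      = ((v ^ (p / 2) : ℝ≥0) : ℝ≥0∞) * ∫⁻ x, ‖x‖ₑ ^ p ∂gaussianReal 0 1 := by
  have h1 : gaussianReal 0 v = (gaussianReal 0 1).map (√(v : ℝ) * ·) := by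
    rw [gaussianReal_map_const_mul, mul_zero, mul_one]
    congr 1
    ext
    simp
  rw [h1, lintegral_map (by fun_prop) (by fun_prop), ← lintegral_const_mul _ (by fun_prop)]
  refine lintegral_congr fun x ↦ ?_
  rw [enorm_mul, ENNReal.mul_rpow_of_nonneg _ _ hp]
  congr 1
  rw [← Real.coe_sqrt, Real.enorm_eq_ofReal (NNReal.coe_nonneg _), ENNReal.ofReal_coe_nnreal,
    ← ENNReal.coe_rpow_of_nonneg _ hp, NNReal.sqrt_eq_rpow, ← NNReal.rpow_mul]
  congr 2
  ring

theorem lintegral_enorm_rpow_gaussianReal_ne_top {p : ℝ} (hp : 0 < p) :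
    ∫⁻ x, ‖x‖ₑ ^ p ∂gaussianReal 0 1 ≠ ∞ := by
  have := memLp_id_gaussianReal (μ := 0) (v := 1) p.toNNReal
  have h := (eLpNorm_lt_top_iff_lintegral_rpow_enorm_lt_top (by simpa using hp) (by simp)).1
    this.eLpNorm_lt_top
  simpa [hp.le] using h.ne

/-- A centered Gaussian process whose increments have variance of Hölder type has a continuous
version. -/
theorem ProbabilityTheory.IsGaussianProcess.exists_isContinuousVersion {X : ℝ≥0 → Ω → ℝ}
    (hX : IsGaussianProcess X P) (hm : ∀ t, ∫ ω, X t ω ∂P = 0) {M : ℝ≥0} {κ : ℝ} (hκ : 0 < κ)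
    (hv : ∀ s t, Var[X s - X t; P] ≤ M * dist s t ^ κ) :
    ∃ Y : ℝ≥0 → Ω → ℝ, IsContinuousVersion Y X P := by
  -- With `p = 4/κ` the moment of order `p`, a multiple of `Var^(p/2)`, is bounded by a multiple of
  -- `|s-t|²`; the exponent `2` exceeds `1`.
  have hp : 0 < 4 / κ := by positivity
  refine exists_isContinuousVersion_of_lintegral_edist_le (p := 4 / κ) (q := 2) hX.aemeasurable hp
    (by norm_num) (M := M ^ (4 / κ / 2) * (∫⁻ x, ‖x‖ₑ ^ (4 / κ) ∂gaussianReal 0 1).toNNReal)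
    fun s t ↦ ?_
  have hg : HasGaussianLaw (X s - X t) P := hX.hasGaussianLaw_sub
  have hmean : P[X s - X t] = 0 := by
    simp only [Pi.sub_apply]
    rw [integral_sub (hX.hasGaussianLaw_eval s).integrable (hX.hasGaussianLaw_eval t).integrable,
      hm, hm, sub_zero]
  have hlaw := hg.map_eq_gaussianReal
  rw [hmean] at hlaw
  calc ∫⁻ ω, edist (X s ω) (X t ω) ^ (4 / κ) ∂P
      = ∫⁻ x, ‖x‖ₑ ^ (4 / κ) ∂(P.map (X s - X t)) := by
        rw [lintegral_map' (by fun_prop) hg.aemeasurable]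
        simp [edist_eq_enorm_sub]
    _ ≤ ((M ^ (4 / κ / 2) : ℝ≥0) : ℝ≥0∞) * edist s t ^ (2 : ℝ)
          * ∫⁻ x, ‖x‖ₑ ^ (4 / κ) ∂gaussianReal 0 1 := by
        rw [hlaw, lintegral_enorm_rpow_gaussianReal hp.le]
        gcongr
        rw [edist_nndist, ← ENNReal.coe_rpow_of_nonneg _ (by norm_num), ← ENNReal.coe_mul,
          ENNReal.coe_le_coe]
        calc (Var[X s - X t; P]).toNNReal ^ (4 / κ / 2)
            ≤ (M * nndist s t ^ κ) ^ (4 / κ / 2) := by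
              refine NNReal.rpow_le_rpow ?_ (by positivity)
              rw [← Real.toNNReal_coe (r := M * nndist s t ^ κ)]
              refine Real.toNNReal_le_toNNReal ?_
              push_cast
              exact hv s t
          _ = _ := by
              rw [NNReal.mul_rpow, ← NNReal.rpow_mul]
              congr 2
              field_simp
              norm_num
    _ = _ := by
        rw [ENNReal.coe_mul, ENNReal.coe_toNNReal (lintegral_enorm_rpow_gaussianReal_ne_top hp)]
        ring

end GaussianContinuity

/-! ### Law, self-similarity and continuity of the root process. -/

namespace IsRootProcess

variable {Ω Ω' : Type*} [MeasurableSpace Ω] [MeasurableSpace Ω'] {P : Measure Ω} {Q : Measure Ω'}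
  {r : ℝ≥0 → Ω → ℝ} {r' : ℝ≥0 → Ω' → ℝ}

/-- The law of the root process is determined by its definition. -/
theorem processEqLaw (hr : IsRootProcess r P) (hr' : IsRootProcess r' Q) :
    ProcessEqLaw r P r' Q := by
  refine hr.gaussian.processEqLaw hr'.gaussian (fun t ↦ by rw [hr.centered, hr'.centered])
    fun s t ↦ ?_
  rcases le_total t s with h | h
  · rw [hr.covariance s t h, hr'.covariance s t h]
  · rw [covariance_comm, covariance_comm (r' s), hr.covariance t s h, hr'.covariance t s h]

theorem isSelfSimilar (hr : IsRootProcess r P) : IsSelfSimilar (1 / 4) r P := by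
  intro a ha
  have hcov : ∀ s t : ℝ≥0, t ≤ s →
      cov[r (a * s), r (a * t); P] =
        cov[fun ω ↦ (a : ℝ) ^ (1 / 4 : ℝ) * r s ω, fun ω ↦ (a : ℝ) ^ (1 / 4 : ℝ) * r t ω; P] := by
    intro s t h
    rw [covariance_const_mul_left, covariance_const_mul_right, hr.covariance s t h,
      hr.covariance (a * s) (a * t) (by gcongr)]
    push_cast
    rw [← mul_add, ← mul_sub, Real.sqrt_mul a.coe_nonneg, Real.sqrt_mul a.coe_nonneg, ← mul_sub, ← mul_assoc,
      ← Real.rpow_add (by exact_mod_cast ha), Real.sqrt_eq_rpow (a : ℝ)]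
    norm_num
  refine (hr.gaussian.comp_right (a * ·)).processEqLaw
    (hr.gaussian.smul fun _ ↦ (a : ℝ) ^ (1 / 4 : ℝ)) (fun t ↦ ?_) fun s t ↦ ?_
  · simp only [Function.comp_apply]
    rw [integral_const_mul, hr.centered, hr.centered, mul_zero]
  · simp only [Function.comp_apply]
    rcases le_total t s with h | h
    · exact hcov s t h
    · rw [covariance_comm, hcov t s h, covariance_comm]

theorem exists_isContinuousVersion (hr : IsRootProcess r P) :
    ∃ Y : ℝ≥0 → Ω → ℝ, IsContinuousVersion Y r P := by
  have := hr.gaussian.isProbabilityMeasure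
  have hL : ∀ t, MemLp (r t) 2 P := fun t ↦ (hr.gaussian.hasGaussianLaw_eval t).memLp_two
  have hv : ∀ s t : ℝ≥0, t ≤ s → Var[r s - r t; P] ≤ 2 * √((s : ℝ) - t) := by
    intro s t h
    rw [← covariance_self (hr.gaussian.hasGaussianLaw_sub).aemeasurable,
      covariance_sub_sub (hL s) (hL t) (hL s) (hL t), covariance_comm (r t) (r s),
      hr.covariance s s le_rfl, hr.covariance t t le_rfl, hr.covariance s t h]
    -- Concavity of the square root at `2s` and `2t`; only `2√(s-t)` then survives in the variance.
    have h1 : √((s : ℝ) + s) + √((t : ℝ) + t) ≤ 2 * √((s : ℝ) + t) := by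
      have hs := Real.sq_sqrt (show (0 : ℝ) ≤ s + s by positivity)
      have ht := Real.sq_sqrt (show (0 : ℝ) ≤ t + t by positivity)
      have hst := Real.sq_sqrt (show (0 : ℝ) ≤ s + t by positivity)
      refine abs_le_of_sq_le_sq' ?_ (by positivity) |>.2
      nlinarith [sq_nonneg (√((s : ℝ) + s) - √((t : ℝ) + t))]
    simp only [sub_self, Real.sqrt_zero]
    linarith
  refine hr.gaussian.exists_isContinuousVersion hr.centered (M := 2) (κ := 1 / 2) (by norm_num)
    fun s t ↦ ?_
  rw [← Real.sqrt_eq_rpow, NNReal.dist_eq]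
  rcases le_total t s with h | h
  · rw [abs_of_nonneg (sub_nonneg.2 (by exact_mod_cast h))]
    exact hv s t h
  · rw [abs_sub_comm, abs_of_nonneg (sub_nonneg.2 (by exact_mod_cast h)), ← neg_sub (r t),
      variance_neg]
    exact hv t s h

end IsRootProcess

/-- In the covariance of `ν(t) - ν(-t)` and `ν(t') - ν(-t')` the one-point terms cancel, and `|t ±
t'|^(1/2)` each occur twice with factor `1/2`. -/
theorem IsTwoSidedFBM.isRootProcess {Ω : Type*} [MeasurableSpace Ω] {Q : Measure Ω}
    {ν : ℝ → Ω → ℝ} (hν : IsTwoSidedFBM (1 / 4) ν Q) :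
    IsRootProcess (fun (t : ℝ≥0) ω ↦ 2 * oddPart ν t ω) Q := by
  have := hν.gaussian.isProbabilityMeasure
  have hL : ∀ t, MemLp (ν t) 2 Q := fun t ↦ (hν.gaussian.hasGaussianLaw_eval t).memLp_two
  have he : ∀ t : ℝ≥0, (fun ω ↦ 2 * oddPart ν t ω) = ν t - ν (-t) := fun t ↦ by
    ext ω
    simp [oddPart]
  refine ⟨?_, fun t ↦ ?_, fun t t' h ↦ ?_⟩
  · classical
    refine hν.gaussian.of_isGaussianProcess fun t ↦ ⟨{(t : ℝ), -(t : ℝ)},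
      .proj (R := ℝ) ⟨(t : ℝ), by simp⟩ - .proj (R := ℝ) ⟨-(t : ℝ), by simp⟩, fun ω ↦ ?_⟩
    exact congrFun (he t) ω
  · rw [he]
    rw [integral_sub' ((hL _).integrable (by norm_num)) ((hL _).integrable (by norm_num)),
      hν.centered, hν.centered, sub_zero]
  · have h1 : (0 : ℝ) ≤ t - t' := sub_nonneg.2 (by exact_mod_cast h)
    have h2 : (0 : ℝ) ≤ t + t' := by positivity
    rw [he, he, covariance_sub_sub (hL _) (hL _) (hL _) (hL _), hν.covariance, hν.covariance,
      hν.covariance, hν.covariance]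
    norm_num
    rw [neg_add_eq_sub, show -(t : ℝ) - t' = -(t + t') by ring, abs_neg, abs_of_nonneg h1,
      abs_of_nonneg h2, abs_sub_comm, abs_of_nonneg h1, Real.sqrt_eq_rpow, Real.sqrt_eq_rpow]
    ring

theorem ProbabilityTheory.covariance_congr {Ω : Type*} [MeasurableSpace Ω] {P : Measure Ω}
    {X X' Y Y' : Ω → ℝ} (hX : X =ᵐ[P] X') (hY : Y =ᵐ[P] Y') : cov[X, Y; P] = cov[X', Y'; P] := by
  rw [covariance, covariance, integral_congr_ae hX, integral_congr_ae hY]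
  refine integral_congr_ae ?_
  filter_upwards [hX, hY] with ω h1 h2
  rw [h1, h2]

/-! ### Covariance of the stochastic convolution with the heat kernel. -/

section HeatKernel

theorem heatKernel_nonneg (t x : ℝ) : 0 ≤ heatKernel t x := by
  unfold heatKernel
  positivity

theorem heatKernel_mul_heatKernel {a b : ℝ} (ha : 0 < a) (hb : 0 < b) (x : ℝ) :
    heatKernel a x * heatKernel b x =
      (√(2 * Real.pi * a) * √(2 * Real.pi * b))⁻¹ *
        Real.exp (-((a + b) / (2 * a * b)) * x ^ 2) := by
  unfold heatKernel
  rw [div_mul_div_comm, ← Real.exp_add, div_eq_inv_mul]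
  congr 2
  field_simp
  ring

theorem integrable_heatKernel_mul_heatKernel {a b : ℝ} (ha : 0 < a) (hb : 0 < b) (x : ℝ) :
    Integrable fun y ↦ heatKernel a (x - y) * heatKernel b (x - y) := by
  simp only [heatKernel_mul_heatKernel ha hb]
  have := (integrable_exp_neg_mul_sq (show 0 < (a + b) / (2 * a * b) by positivity)).const_mul
    (√(2 * Real.pi * a) * √(2 * Real.pi * b))⁻¹
  exact this.comp_sub_left x

/-- The semigroup property of the heat kernel, on the diagonal. -/
theorem integral_heatKernel_mul_heatKernel {a b : ℝ} (ha : 0 < a) (hb : 0 < b) (x : ℝ) :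
    ∫ y, heatKernel a (x - y) * heatKernel b (x - y) = (√(2 * Real.pi * (a + b)))⁻¹ := by
  rw [integral_sub_left_eq_self (fun y ↦ heatKernel a y * heatKernel b y)]
  simp only [heatKernel_mul_heatKernel ha hb]
  rw [integral_const_mul, integral_gaussian, ← Real.sqrt_mul (by positivity), ← Real.sqrt_inv,
    ← Real.sqrt_mul (by positivity), ← Real.sqrt_inv]
  congr 1
  have := Real.pi_pos
  field_simp

theorem measurable_convolutionKernel (x t : ℝ) : Measurable (convolutionKernel x t) := by
  unfold convolutionKernel heatKernel
  refine Measurable.ite ?_ (by fun_prop) measurable_const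
  exact (measurableSet_le measurable_const measurable_snd).inter
    (measurableSet_lt measurable_snd measurable_const)

/-- The primitive is `-√(2π(t+t'-2s))/(2π)`. For `t = t'` the integrand blows up at `s = t'`;
positivity of the derivative of a continuous function gives integrability there. -/
theorem integrableOn_and_integral_inv_sqrt {t t' : ℝ} (h0 : 0 ≤ t') (h : t' ≤ t) :
    IntegrableOn (fun s ↦ (√(2 * Real.pi * (t + t' - 2 * s)))⁻¹) (Set.Ico 0 t') ∧
    ∫ s in Set.Ico 0 t', (√(2 * Real.pi * (t + t' - 2 * s)))⁻¹ =
      (√(2 * Real.pi))⁻¹ * (√(t + t') - √(t - t')) := by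
  have hpi := Real.pi_pos
  set F : ℝ → ℝ := fun s ↦ -√(2 * Real.pi * (t + t' - 2 * s)) / (2 * Real.pi) with hF
  have hc : ContinuousOn F (Set.Icc 0 t') := by fun_prop
  have hd : ∀ s ∈ Set.Ioo 0 t', HasDerivAt F (√(2 * Real.pi * (t + t' - 2 * s)))⁻¹ s := by
    intro s hs
    have hpos : 0 < t + t' - 2 * s := by linarith [hs.2]
    have h1 : HasDerivAt (fun s ↦ 2 * Real.pi * (t + t' - 2 * s)) (2 * Real.pi * (-(2 * 1))) s :=
      (((hasDerivAt_id s).const_mul 2).const_sub _).const_mul _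
    have h2 := ((h1.sqrt (by positivity)).neg).div_const (2 * Real.pi)
    have : √(2 * Real.pi * (t + t' - 2 * s)) ≠ 0 := by positivity
    exact h2.congr_deriv (by field_simp)
  have hi : IntegrableOn (fun s ↦ (√(2 * Real.pi * (t + t' - 2 * s)))⁻¹) (Set.Ioc 0 t') :=
    intervalIntegral.integrableOn_deriv_of_nonneg hc hd fun s _ ↦ by positivity
  refine ⟨(integrableOn_Ico_iff_integrableOn_Ioo (by simp)).2 (hi.mono_set Set.Ioo_subset_Ioc_self), ?_⟩
  rw [integral_Ico_eq_integral_Ioo, ← integral_Ioc_eq_integral_Ioo,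
    ← intervalIntegral.integral_of_le h0,
    intervalIntegral.integral_eq_sub_of_hasDerivAt_of_le h0 hc hd
      ((intervalIntegrable_iff_integrableOn_Ioc_of_le h0).2 hi), hF]
  simp only [mul_zero, sub_zero]
  rw [show t + t' - 2 * t' = t - t' by ring, Real.sqrt_mul (x := 2 * Real.pi) (by positivity),
    Real.sqrt_mul (x := 2 * Real.pi) (by positivity)]
  have h2 : √(2 * Real.pi) ≠ 0 := by positivity
  have h3 : (2 * Real.pi) = √(2 * Real.pi) * √(2 * Real.pi) :=
    (Real.mul_self_sqrt (by positivity)).symm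
  have h4 : ∀ u v w : ℝ, w ≠ 0 → -(w * u) / (w * w) - -(w * v) / (w * w) = w⁻¹ * (v - u) := by
    intro u v w hw
    field_simp
    ring
  rw [← h4 _ _ _ h2, ← h3]

theorem convolutionKernel_mul_self {t t' : ℝ} (h : t' ≤ t) (x y s : ℝ) :
    convolutionKernel x t (y, s) * convolutionKernel x t' (y, s) =
      (Set.Ico 0 t').indicator
        (fun s ↦ heatKernel (t - s) (x - y) * heatKernel (t' - s) (x - y)) s := by
  unfold convolutionKernel
  by_cases hs : 0 ≤ s ∧ s < t'
  · rw [if_pos ⟨hs.1, hs.2.trans_le h⟩, if_pos hs, Set.indicator_of_mem (by exact hs)]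
  · rw [if_neg hs, mul_zero, Set.indicator_of_notMem (by exact hs)]

/-- Integrate in space first, where the semigroup property applies with times `t - s` and `t' - s`,
then in `s`. All integrands are nonnegative, so this also proves integrability. -/
theorem integrable_and_integral_convolutionKernel_mul {t t' : ℝ} (h0 : 0 ≤ t') (h : t' ≤ t)
    (x : ℝ) :
    Integrable (fun q ↦ convolutionKernel x t q * convolutionKernel x t' q) spaceTimeVolume ∧
    ∫ q, convolutionKernel x t q * convolutionKernel x t' q ∂spaceTimeVolume =
      (√(2 * Real.pi))⁻¹ * (√(t + t') - √(t - t')) := by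
  obtain ⟨hgi, hg⟩ := integrableOn_and_integral_inv_sqrt h0 h
  have hslice : ∀ s, Integrable (fun y ↦ convolutionKernel x t (y, s) *
      convolutionKernel x t' (y, s)) ∧
      ∫ y, convolutionKernel x t (y, s) * convolutionKernel x t' (y, s) =
        (Set.Ico 0 t').indicator (fun s ↦ (√(2 * Real.pi * (t + t' - 2 * s)))⁻¹) s := by
    intro s
    simp only [convolutionKernel_mul_self h]
    by_cases hs : s ∈ Set.Ico 0 t'
    · simp only [Set.indicator_of_mem hs]
      have h1 : 0 < t - s := by linarith [hs.2]
      have h2 : 0 < t' - s := by linarith [hs.2]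
      refine ⟨integrable_heatKernel_mul_heatKernel h1 h2 x, ?_⟩
      rw [integral_heatKernel_mul_heatKernel h1 h2]
      congr 3
      ring
    · simp [Set.indicator_of_notMem hs]
  have hIci : (Set.Ico 0 t') ∩ Set.Ici 0 = Set.Ico 0 t' :=
    Set.inter_eq_left.2 Set.Ico_subset_Ici_self
  have hi : Integrable (fun q ↦ convolutionKernel x t q * convolutionKernel x t' q)
      spaceTimeVolume := by
    refine (integrable_prod_iff' ((measurable_convolutionKernel x t).mul
      (measurable_convolutionKernel x t')).aestronglyMeasurable).2
      ⟨ae_of_all _ fun s ↦ (hslice s).1, ?_⟩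
    have : ∀ s, ∫ y, ‖convolutionKernel x t (y, s) * convolutionKernel x t' (y, s)‖ =
        (Set.Ico 0 t').indicator (fun s ↦ (√(2 * Real.pi * (t + t' - 2 * s)))⁻¹) s := by
      intro s
      rw [← (hslice s).2]
      refine integral_congr_ae (ae_of_all _ fun y ↦ ?_)
      simp only [convolutionKernel_mul_self h]
      refine Real.norm_of_nonneg (Set.indicator_nonneg (fun s _ ↦ ?_) s)
      exact mul_nonneg (heatKernel_nonneg _ _) (heatKernel_nonneg _ _)
    refine (integrable_congr (ae_of_all _ this)).2 ?_
    rw [integrable_indicator_iff measurableSet_Ico, IntegrableOn,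
      Measure.restrict_restrict measurableSet_Ico, hIci]
    exact hgi
  refine ⟨hi, ?_⟩
  rw [spaceTimeVolume, integral_prod_symm _ hi]
  simp only [(hslice _).2]
  rw [integral_indicator measurableSet_Ico, Measure.restrict_restrict measurableSet_Ico, hIci, hg]

theorem memLp_convolutionKernel (x : ℝ) {t : ℝ} (ht : 0 ≤ t) :
    MemLp (convolutionKernel x t) 2 spaceTimeVolume := by
  rw [memLp_two_iff_integrable_sq (measurable_convolutionKernel x t).aestronglyMeasurable]
  simpa only [pow_two] using (integrable_and_integral_convolutionKernel_mul ht le_rfl x).1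

theorem inner_toLp_convolutionKernel {t t' : ℝ} (h0 : 0 ≤ t') (h : t' ≤ t) (x : ℝ) :
    inner ℝ ((memLp_convolutionKernel x (h0.trans h)).toLp (convolutionKernel x t))
      ((memLp_convolutionKernel x h0).toLp (convolutionKernel x t')) =
      (√(2 * Real.pi))⁻¹ * (√(t + t') - √(t - t')) := by
  rw [L2.inner_def, ← (integrable_and_integral_convolutionKernel_mul h0 h x).2]
  refine integral_congr_ae ?_
  filter_upwards [(memLp_convolutionKernel x (h0.trans h)).coeFn_toLp,
    (memLp_convolutionKernel x h0).coeFn_toLp] with q h1 h2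
  rw [h1, h2]
  exact mul_comm _ _

end HeatKernel

/-! ### The stochastic heat equation at the origin, and existence of the root process. -/

section StochasticHeatEquation

variable {Ω : Type*} [MeasurableSpace Ω] {Q : Measure Ω} {W : Lp ℝ 2 spaceTimeVolume → Ω → ℝ}

theorem exists_isStochasticHeatSolution (W : Lp ℝ 2 spaceTimeVolume → Ω → ℝ) (Q : Measure Ω) :
    ∃ h : ℝ → ℝ≥0 → Ω → ℝ, IsStochasticHeatSolution W Q (fun _ ↦ 0) h := by
  classical
  refine ⟨fun x t ω ↦ if 0 < t then
    W ((memLp_convolutionKernel x t.coe_nonneg).toLp (convolutionKernel x t)) ω else 0,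
    fun x ↦ ?_, fun x t _ ↦ ?_, fun x t ht ↦ ⟨memLp_convolutionKernel x t.coe_nonneg, ?_⟩⟩
  · simp
  · simp
  · simp [ht]

theorem IsStochasticHeatSolution.isRootProcess (hW : IsWhiteNoise spaceTimeVolume W Q)
    {h : ℝ → ℝ≥0 → Ω → ℝ} (hh : IsStochasticHeatSolution W Q (fun _ ↦ 0) h) :
    IsRootProcess (fun t ω ↦ (2 * Real.pi) ^ (1 / 4 : ℝ) * h 0 t ω) Q := by
  have := hW.gaussian.isProbabilityMeasure
  set f : ℝ≥0 → Lp ℝ 2 spaceTimeVolume := fun t ↦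
    (memLp_convolutionKernel 0 t.coe_nonneg).toLp (convolutionKernel 0 t) with hf
  have hWh : ∀ t, W (f t) =ᵐ[Q] h 0 t := by
    intro t
    -- At time `0` the mild formula is not imposed. There the kernel vanishes, and `W 0` has
    -- variance zero, so it agrees almost surely with the initial value `0`.
    rcases eq_zero_or_pos t with rfl | ht
    · have h0 : f 0 = 0 := by
        rw [hf, Lp.eq_zero_iff_ae_eq_zero]
        filter_upwards [(memLp_convolutionKernel 0 (0 : ℝ≥0).coe_nonneg).coeFn_toLp] with q hq
        rw [hq, convolutionKernel, if_neg (by simp)]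
        rfl
      have hv := hW.covariance 0 0
      have hL : MemLp (W 0) 2 Q := (hW.gaussian.hasGaussianLaw_eval 0).memLp_two
      rw [covariance_self hL.aemeasurable, inner_zero_left] at hv
      have := ae_eq_integral_of_variance_eq_zero hL hv
      rw [h0]
      filter_upwards [this, hh.initial 0] with ω h1 h2
      rw [h1, hW.centered, h2]
    · obtain ⟨hG, hG'⟩ := hh.mild 0 t ht
      filter_upwards [hG'] with ω hω
      rw [hω]
      simp [hf]
  set c : ℝ := (2 * Real.pi) ^ (1 / 4 : ℝ) with hc
  have hcc : c * c = √(2 * Real.pi) := by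
    rw [hc, ← Real.rpow_add (by positivity), Real.sqrt_eq_rpow]
    norm_num
  refine ⟨((hW.gaussian.comp_right f).congr hWh).smul fun _ ↦ c, fun t ↦ ?_, fun t t' htt ↦ ?_⟩
  · rw [integral_const_mul, ← integral_congr_ae (hWh t), hW.centered, mul_zero]
  · rw [covariance_const_mul_left, covariance_const_mul_right,
      ← covariance_congr (hWh t) (hWh t'), hW.covariance, hf,
      inner_toLp_convolutionKernel t'.coe_nonneg (by exact_mod_cast htt), ← mul_assoc, hcc,
      ← mul_assoc, mul_inv_cancel₀ (by positivity), one_mul]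

end StochasticHeatEquation

theorem exists_isRootProcess :
    ∃ (Ω : Type) (_ : MeasurableSpace Ω) (P : Measure Ω) (r : ℝ≥0 → Ω → ℝ), IsRootProcess r P := by
  obtain ⟨Ω, mΩ, P, W, hg, hm, hc⟩ := exists_isonormalProcess (H := Lp ℝ 2 spaceTimeVolume)
  obtain ⟨h, hh⟩ := exists_isStochasticHeatSolution W P
  exact ⟨Ω, mΩ, P, _, hh.isRootProcess ⟨hg, hm, hc⟩⟩

/-! ### A Landen-type transformation and the beta integral. -/

section LandenIntegral

/-- The integrand `u^{1/2} (1 + u²)^{-5/4} (1 + κ² u²)^{-1/4}`. -/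
noncomputable def landenIntegrand (κ u : ℝ) : ℝ :=
  (u ^ 2 / ((1 + u ^ 2) * (1 + κ ^ 2 * u ^ 2))) ^ (1 / 4 : ℝ) / (1 + u ^ 2)

/-- The integral `∫₀^∞ u^{1/2} (1 + u²)^{-5/4} (1 + κ² u²)^{-1/4} du`. -/
noncomputable def landenIntegral (κ : ℝ) : ℝ := ∫ u in Set.Ioi 0, landenIntegrand κ u

theorem quarticRoot_pow_four {x : ℝ} (hx : 0 ≤ x) : (x ^ (1 / 4 : ℝ)) ^ 4 = x := by
  rw [← Real.rpow_natCast, ← Real.rpow_mul hx]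
  norm_num

theorem landenRatio_mem_Icc (κ u : ℝ) :
    0 ≤ u ^ 2 / ((1 + u ^ 2) * (1 + κ ^ 2 * u ^ 2)) ∧
      u ^ 2 / ((1 + u ^ 2) * (1 + κ ^ 2 * u ^ 2)) ≤ 1 := by
  refine ⟨by positivity, ?_⟩
  rw [div_le_one (by positivity)]
  nlinarith [sq_nonneg u, sq_nonneg (κ * u), sq_nonneg (κ * u ^ 2)]

theorem continuous_landenIntegrand : Continuous fun p : ℝ × ℝ ↦ landenIntegrand p.1 p.2 := by
  unfold landenIntegrand
  refine Continuous.div (Continuous.rpow_const (Continuous.div (by fun_prop) (by fun_prop)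
    fun p ↦ by positivity) fun p ↦ Or.inr (by norm_num)) (by fun_prop) fun p ↦ by positivity

/-- The bound is uniform in `κ`, so it serves both for integrability and for dominated convergence
in `κ`. -/
theorem norm_landenIntegrand_le (κ u : ℝ) : ‖landenIntegrand κ u‖ ≤ (1 + u ^ 2)⁻¹ := by
  obtain ⟨h0, h1⟩ := landenRatio_mem_Icc κ u
  have h2 := Real.rpow_le_one h0 h1 (show (0 : ℝ) ≤ 1 / 4 by norm_num)
  rw [landenIntegrand, Real.norm_of_nonneg (by positivity), ← one_div]
  gcongr

theorem integrable_landenIntegrand (κ : ℝ) : Integrable (landenIntegrand κ) :=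
  integrable_inv_one_add_sq.mono'
    (continuous_landenIntegrand.comp (by fun_prop : Continuous fun u ↦ (κ, u))).aestronglyMeasurable
    (ae_of_all _ (norm_landenIntegrand_le κ))

/-- Continuity is needed to reach `κ = 0`, the case `t = t'`, where the substitution `u = 1/(κv)`
degenerates. -/
theorem continuous_landenIntegral : Continuous landenIntegral := by
  refine continuous_of_dominated (fun κ ↦ (integrable_landenIntegrand κ).1.restrict)
    (fun κ ↦ ae_of_all _ (norm_landenIntegrand_le κ)) integrable_inv_one_add_sq.integrableOn
    (ae_of_all _ fun u ↦ ?_)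
  exact continuous_landenIntegrand.comp (by fun_prop : Continuous fun κ ↦ (κ, u))

theorem image_inv_mul_Ioi {κ : ℝ} (hκ : 0 < κ) :
    (fun v : ℝ ↦ (κ * v)⁻¹) '' Set.Ioi 0 = Set.Ioi 0 := by
  ext u
  simp only [Set.mem_image, Set.mem_Ioi]
  constructor
  · rintro ⟨v, hv, rfl⟩
    positivity
  · intro hu
    refine ⟨(κ * u)⁻¹, by positivity, ?_⟩
    field_simp

/-- The substitution `u = 1 / (κ v)`. -/
theorem landenIntegral_eq_inversion {κ : ℝ} (hκ : 0 < κ) :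
    IntegrableOn (fun v ↦ (v ^ 2 / ((1 + v ^ 2) * (1 + κ ^ 2 * v ^ 2))) ^ (1 / 4 : ℝ) *
      (κ / (1 + κ ^ 2 * v ^ 2))) (Set.Ioi 0) ∧
    landenIntegral κ = ∫ v in Set.Ioi 0,
      (v ^ 2 / ((1 + v ^ 2) * (1 + κ ^ 2 * v ^ 2))) ^ (1 / 4 : ℝ) * (κ / (1 + κ ^ 2 * v ^ 2)) := by
  have hd : ∀ v ∈ Set.Ioi (0 : ℝ), HasDerivWithinAt (fun v : ℝ ↦ (κ * v)⁻¹)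
      (-(κ / (κ * v) ^ 2)) (Set.Ioi 0) v := by
    intro v hv
    have hv' : κ * v ≠ 0 := mul_ne_zero hκ.ne' (ne_of_gt hv)
    have := ((hasDerivAt_id v).const_mul κ).inv hv'
    exact (this.congr_deriv (by simp [neg_div])).hasDerivWithinAt
  have hanti : AntitoneOn (fun v : ℝ ↦ (κ * v)⁻¹) (Set.Ioi 0) := by
    intro v hv w hw hvw
    simp only [Set.mem_Ioi] at hv hw
    simp only
    gcongr
  have heq : Set.EqOn (fun v : ℝ ↦ (-(-(κ / (κ * v) ^ 2))) • landenIntegrand κ (κ * v)⁻¹)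
      (fun v ↦ (v ^ 2 / ((1 + v ^ 2) * (1 + κ ^ 2 * v ^ 2))) ^ (1 / 4 : ℝ) *
        (κ / (1 + κ ^ 2 * v ^ 2))) (Set.Ioi 0) := by
    intro v hv
    have hv0 : v ≠ 0 := ne_of_gt hv
    simp only [landenIntegrand, smul_eq_mul, neg_neg]
    have h1 : (κ * v)⁻¹ ^ 2 / ((1 + (κ * v)⁻¹ ^ 2) * (1 + κ ^ 2 * (κ * v)⁻¹ ^ 2)) =
        v ^ 2 / ((1 + v ^ 2) * (1 + κ ^ 2 * v ^ 2)) := by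
      field_simp
      ring
    rw [h1, mul_div_left_comm]
    congr 1
    field_simp
    ring
  have hi := (integrable_landenIntegrand κ).integrableOn (s := Set.Ioi 0)
  constructor
  · rw [← image_inv_mul_Ioi hκ, integrableOn_image_iff_integrableOn_deriv_smul_of_antitoneOn
      measurableSet_Ioi hd hanti] at hi
    exact (integrableOn_congr_fun heq measurableSet_Ioi).1 hi
  · rw [landenIntegral, ← setIntegral_congr_fun measurableSet_Ioi heq]
    conv_lhs => rw [← image_inv_mul_Ioi hκ]
    exact integral_image_eq_integral_deriv_smul_of_antitoneOn measurableSet_Ioi hd hanti _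

/-- The preimage of `z` is the positive root of `κv² + (1+κ)zv - 1 = 0`. -/
theorem image_landen_Ioi {κ : ℝ} (hκ : 0 < κ) :
    (fun v : ℝ ↦ ((1 + κ) * v)⁻¹ - κ / (1 + κ) * v) '' Set.Ioi 0 = Set.univ := by
  refine Set.eq_univ_of_forall fun z ↦ ?_
  set D : ℝ := √((1 + κ) ^ 2 * z ^ 2 + 4 * κ) with hD
  have hDsq : D ^ 2 = (1 + κ) ^ 2 * z ^ 2 + 4 * κ := Real.sq_sqrt (by positivity)
  have hDgt : (1 + κ) * z < D := Real.lt_sqrt_of_sq_lt (by nlinarith)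
  have hpos : 0 < (D - (1 + κ) * z) / (2 * κ) := div_pos (by linarith) (by linarith)
  refine ⟨(D - (1 + κ) * z) / (2 * κ), hpos, ?_⟩
  have h1 : D - (1 + κ) * z ≠ 0 := by linarith
  simp only
  field_simp
  nlinarith

/-- The substitution `z = (1 - κ v²) / ((1 + κ) v)`, as in Landen's transformation. -/
theorem landenIntegral_mul_sqrt {κ : ℝ} (hκ : 0 < κ) :
    landenIntegral κ * √(1 + κ) = (∫ z : ℝ, ((1 + z ^ 2)⁻¹) ^ (1 / 4 : ℝ) * (1 + z ^ 2)⁻¹) / 2 := by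
  obtain ⟨hi, hI⟩ := landenIntegral_eq_inversion hκ
  -- The inversion keeps the fourth root and changes only the weight. Added together, the two
  -- weights are the derivative of `arctan v + arctan (κv)`.
  have hsum : landenIntegral κ + landenIntegral κ = ∫ v in Set.Ioi 0, (landenIntegrand κ v +
      (v ^ 2 / ((1 + v ^ 2) * (1 + κ ^ 2 * v ^ 2))) ^ (1 / 4 : ℝ) * (κ / (1 + κ ^ 2 * v ^ 2))) := by
    rw [integral_add (integrable_landenIntegrand κ).integrableOn hi, ← hI, landenIntegral]
  have hd : ∀ v ∈ Set.Ioi (0 : ℝ), HasDerivWithinAt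
      (fun v : ℝ ↦ ((1 + κ) * v)⁻¹ - κ / (1 + κ) * v)
      (-((1 + κ) / ((1 + κ) * v) ^ 2) - κ / (1 + κ)) (Set.Ioi 0) v := by
    intro v hv
    have hv' : (1 + κ) * v ≠ 0 := mul_ne_zero (by positivity) (ne_of_gt hv)
    have := (((hasDerivAt_id v).const_mul (1 + κ)).inv hv').sub
      ((hasDerivAt_id v).const_mul (κ / (1 + κ)))
    exact (this.congr_deriv (by simp only [id, mul_one, neg_div])).hasDerivWithinAt
  have hanti : AntitoneOn (fun v : ℝ ↦ ((1 + κ) * v)⁻¹ - κ / (1 + κ) * v) (Set.Ioi 0) := by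
    intro v hv w hw hvw
    simp only [Set.mem_Ioi] at hv hw
    simp only
    gcongr
  have heq : Set.EqOn (fun v : ℝ ↦ (-(-((1 + κ) / ((1 + κ) * v) ^ 2) - κ / (1 + κ))) •
      (((1 + (((1 + κ) * v)⁻¹ - κ / (1 + κ) * v) ^ 2)⁻¹) ^ (1 / 4 : ℝ) *
        (1 + (((1 + κ) * v)⁻¹ - κ / (1 + κ) * v) ^ 2)⁻¹))
      (fun v ↦ √(1 + κ) * (landenIntegrand κ v +
        (v ^ 2 / ((1 + v ^ 2) * (1 + κ ^ 2 * v ^ 2))) ^ (1 / 4 : ℝ) *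
          (κ / (1 + κ ^ 2 * v ^ 2)))) (Set.Ioi 0) := by
    intro v hv
    have hv0 : v ≠ 0 := ne_of_gt hv
    have h1κ : 0 < 1 + κ := by positivity
    simp only [landenIntegrand, smul_eq_mul]
    -- This is the identity `(1-κv²)² + (1+κ)²v² = (1+v²)(1+κ²v²)`.
    have h1 : (1 + (((1 + κ) * v)⁻¹ - κ / (1 + κ) * v) ^ 2)⁻¹ =
        (1 + κ) ^ 2 * (v ^ 2 / ((1 + v ^ 2) * (1 + κ ^ 2 * v ^ 2))) := by
      rw [inv_eq_iff_eq_inv]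
      field_simp
      ring
    have h2 : ((1 + κ) ^ 2 : ℝ) ^ (1 / 4 : ℝ) = √(1 + κ) := by
      rw [Real.sqrt_eq_rpow, ← Real.rpow_natCast, ← Real.rpow_mul h1κ.le]
      norm_num
    rw [h1, Real.mul_rpow (by positivity) (by positivity), h2]
    set R := (v ^ 2 / ((1 + v ^ 2) * (1 + κ ^ 2 * v ^ 2))) ^ (1 / 4 : ℝ)
    -- The arctangent addition formula in differential form: `z` is the cotangent of `arctan v +
    -- arctan (κv)`.
    have h3 : (-(-((1 + κ) / ((1 + κ) * v) ^ 2) - κ / (1 + κ))) *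
        ((1 + κ) ^ 2 * (v ^ 2 / ((1 + v ^ 2) * (1 + κ ^ 2 * v ^ 2)))) =
        1 / (1 + v ^ 2) + κ / (1 + κ ^ 2 * v ^ 2) := by
      field_simp
      ring
    calc _ = √(1 + κ) * R * ((-(-((1 + κ) / ((1 + κ) * v) ^ 2) - κ / (1 + κ))) *
        ((1 + κ) ^ 2 * (v ^ 2 / ((1 + v ^ 2) * (1 + κ ^ 2 * v ^ 2))))) := by ring
      _ = _ := by rw [h3]; ring
  have hsub := integral_image_eq_integral_deriv_smul_of_antitoneOn measurableSet_Ioi hd hanti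
    fun z ↦ ((1 + z ^ 2)⁻¹) ^ (1 / 4 : ℝ) * (1 + z ^ 2)⁻¹
  rw [image_landen_Ioi hκ, setIntegral_univ, setIntegral_congr_fun measurableSet_Ioi heq,
    integral_const_mul, ← hsum] at hsub
  rw [hsub]
  ring

theorem landenIntegral_mul_sqrt_eq {κ : ℝ} (hκ : 0 ≤ κ) :
    landenIntegral κ * √(1 + κ) = landenIntegral 1 * √2 := by
  have h1 : Set.EqOn (fun κ ↦ landenIntegral κ * √(1 + κ)) (fun _ ↦ landenIntegral 1 * √2)
      (Set.Ioi 0) := fun κ hκ ↦ by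
    simp only
    rw [landenIntegral_mul_sqrt hκ, ← landenIntegral_mul_sqrt one_pos]
    norm_num
  have h2 := h1.closure (continuous_landenIntegral.mul (by fun_prop)) continuous_const
  rw [closure_Ioi] at h2
  exact h2 hκ

theorem image_sq_div_Ioi : (fun u : ℝ ↦ 1 - (1 + u ^ 2)⁻¹) '' Set.Ioi 0 = Set.Ioo 0 1 := by
  ext x
  simp only [Set.mem_image, Set.mem_Ioi, Set.mem_Ioo]
  constructor
  · rintro ⟨u, hu, rfl⟩
    have h1 : (1 + u ^ 2)⁻¹ < 1 := inv_lt_one_of_one_lt₀ (by nlinarith)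
    have h2 : 0 < (1 + u ^ 2)⁻¹ := by positivity
    constructor <;> linarith
  · rintro ⟨h0, h1⟩
    have h2 : 0 < 1 - x := by linarith
    refine ⟨√(x / (1 - x)), by positivity, ?_⟩
    rw [Real.sq_sqrt (by positivity)]
    field_simp
    ring

/-- The substitution `x = u²/(1+u²)` turns the beta integral of `(x(1-x))^(-1/4)` into twice the
Landen integral at `κ = 1`. -/
theorem landenIntegral_one : landenIntegral 1 = 1 / 2 * beta (3 / 4) (3 / 4) := by
  have hbeta : beta (3 / 4) (3 / 4) = ∫ x in Set.Ioo (0 : ℝ) 1, ((x * (1 - x)) ^ (1 / 4 : ℝ))⁻¹ := by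
    rw [beta_eq_betaIntegralReal _ _ (by norm_num) (by norm_num), Complex.betaIntegral,
      intervalIntegral.integral_of_le zero_le_one, integral_Ioc_eq_integral_Ioo,
      setIntegral_congr_fun (g := fun x : ℝ ↦ ((((x * (1 - x)) ^ (1 / 4 : ℝ))⁻¹ : ℝ) : ℂ))
        measurableSet_Ioo, integral_complex_ofReal, Complex.ofReal_re]
    intro x hx
    have h1 : 0 ≤ 1 - x := by linarith [hx.2]
    simp only
    rw [Real.mul_rpow hx.1.le h1, mul_inv, ← Real.rpow_neg hx.1.le, ← Real.rpow_neg h1,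
      Complex.ofReal_mul, Complex.ofReal_cpow hx.1.le, Complex.ofReal_cpow h1]
    push_cast
    norm_num
  have hd : ∀ u ∈ Set.Ioi (0 : ℝ), HasDerivWithinAt (fun u : ℝ ↦ 1 - (1 + u ^ 2)⁻¹)
      (2 * u / (1 + u ^ 2) ^ 2) (Set.Ioi 0) u := by
    intro u hu
    have hne : 1 + u ^ 2 ≠ 0 := by positivity
    have := (((hasDerivAt_pow 2 u).const_add 1).inv hne).const_sub 1
    exact (this.congr_deriv (by simp [neg_div])).hasDerivWithinAt
  have hmono : MonotoneOn (fun u : ℝ ↦ 1 - (1 + u ^ 2)⁻¹) (Set.Ioi 0) := by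
    intro v hv w hw hvw
    simp only [Set.mem_Ioi] at hv hw
    simp only
    gcongr
  have heq : Set.EqOn (fun u : ℝ ↦ (2 * u / (1 + u ^ 2) ^ 2) •
      (((1 - (1 + u ^ 2)⁻¹) * (1 - (1 - (1 + u ^ 2)⁻¹))) ^ (1 / 4 : ℝ))⁻¹)
      (fun u ↦ 2 * landenIntegrand 1 u) (Set.Ioi 0) := by
    intro u hu
    have hu0 : 0 < u := hu
    have h1 : (1 - (1 + u ^ 2)⁻¹) * (1 - (1 - (1 + u ^ 2)⁻¹)) = u ^ 2 / (1 + u ^ 2) ^ 2 := by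
      field_simp
      ring
    simp only [landenIntegrand, smul_eq_mul]
    rw [h1]
    -- Both sides are nonnegative; comparing fourth powers removes the fractional exponents.
    refine (pow_left_inj₀ (by positivity) (by positivity) (show 4 ≠ 0 by norm_num)).1 ?_
    simp only [mul_pow, div_pow, inv_pow]
    rw [quarticRoot_pow_four (by positivity), quarticRoot_pow_four (by positivity)]
    field_simp
  have hsub := integral_image_eq_integral_deriv_smul_of_monotoneOn measurableSet_Ioi hd hmono
    fun x ↦ ((x * (1 - x)) ^ (1 / 4 : ℝ))⁻¹
  rw [image_sq_div_Ioi, ← hbeta, setIntegral_congr_fun measurableSet_Ioi heq,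
    integral_const_mul] at hsub
  rw [hsub, landenIntegral]
  ring

end LandenIntegral

/-! ### Inner products of the kernels `rootKernel t` in `L²(0,∞)`. -/

section RootKernel

theorem rootKernel_nonneg (t s : ℝ) : 0 ≤ rootKernel t s := by
  unfold rootKernel
  split_ifs with h
  · have : 0 ≤ t ^ 2 - s ^ 2 := by nlinarith
    have := h.1
    positivity
  · exact le_rfl

theorem measurable_rootKernel (t : ℝ) : Measurable (rootKernel t) := by
  unfold rootKernel
  refine Measurable.ite ?_ (by fun_prop) measurable_const
  exact measurableSet_Ioo

theorem rootKernel_mul_rootKernel {t t' s : ℝ} (h : t' ≤ t) :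
    rootKernel t s * rootKernel t' s = (Set.Ioo 0 t').indicator
      (fun s ↦ (s ^ 2 / ((t ^ 2 - s ^ 2) * (t' ^ 2 - s ^ 2))) ^ (1 / 4 : ℝ)) s := by
  unfold rootKernel
  by_cases hs : 0 < s ∧ s < t'
  · have h1 : 0 ≤ t' ^ 2 - s ^ 2 := by nlinarith
    have h2 : 0 ≤ t ^ 2 - s ^ 2 := by nlinarith
    rw [if_pos ⟨hs.1, hs.2.trans_le h⟩, if_pos hs, Set.indicator_of_mem (by exact hs),
      div_mul_div_comm, ← Real.mul_rpow hs.1.le hs.1.le, ← Real.mul_rpow h2 h1,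
      ← Real.div_rpow (mul_nonneg hs.1.le hs.1.le) (mul_nonneg h2 h1), pow_two s]
  · rw [if_neg hs, mul_zero, Set.indicator_of_notMem (by exact hs)]

/-- This is `s = a sin θ` parametrized by `u = tan θ`. -/
theorem image_mul_div_sqrt_Ioi {a : ℝ} (ha : 0 < a) :
    (fun u : ℝ ↦ a * u / √(1 + u ^ 2)) '' Set.Ioi 0 = Set.Ioo 0 a := by
  ext s
  simp only [Set.mem_image, Set.mem_Ioi, Set.mem_Ioo]
  constructor
  · rintro ⟨u, hu, rfl⟩
    refine ⟨by positivity, ?_⟩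
    rw [div_lt_iff₀ (by positivity)]
    gcongr
    exact Real.lt_sqrt_of_sq_lt (by linarith)
  · rintro ⟨h0, h1⟩
    have h2 : 0 < a ^ 2 - s ^ 2 := by nlinarith
    refine ⟨s / √(a ^ 2 - s ^ 2), by positivity, ?_⟩
    rw [div_pow, Real.sq_sqrt h2.le, show 1 + s ^ 2 / (a ^ 2 - s ^ 2) = a ^ 2 / (a ^ 2 - s ^ 2) by
      field_simp; ring, Real.sqrt_div (by positivity), Real.sqrt_sq ha.le]
    field_simp

/-- For `t' > 0`, put `s = t'u/√(1+u²)` and `κ² = 1 - (t'/t)²`: the integral becomes `(t'/√t) *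
landenIntegral κ`, which is known up to the factor `√2/√(1+κ)` from `κ = 1`. -/
theorem integrableOn_and_integral_rootKernel_mul {t t' : ℝ} (h0 : 0 ≤ t') (h : t' ≤ t) :
    IntegrableOn (fun s ↦ rootKernel t s * rootKernel t' s) (Set.Ioi 0) ∧
    ∫ s in Set.Ioi 0, rootKernel t s * rootKernel t' s =
      (1 / 2 * beta (3 / 4) (3 / 4)) * (√(t + t') - √(t - t')) := by
  simp only [rootKernel_mul_rootKernel h]
  rcases h0.eq_or_lt with rfl | h0
  · simp
  have ht : 0 < t := h0.trans_le h
  set g : ℝ → ℝ := fun s ↦ (s ^ 2 / ((t ^ 2 - s ^ 2) * (t' ^ 2 - s ^ 2))) ^ (1 / 4 : ℝ) with hg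
  have hx : t' / t ≤ 1 := (div_le_one ht).2 h
  have hκ0 : 0 ≤ 1 - (t' / t) ^ 2 := by
    have : 0 < t' / t := by positivity
    nlinarith
  set κ : ℝ := √(1 - (t' / t) ^ 2) with hκ
  have hκn : 0 ≤ κ := Real.sqrt_nonneg _
  have hκsq : κ ^ 2 = 1 - (t' / t) ^ 2 := Real.sq_sqrt hκ0
  have hd : ∀ u ∈ Set.Ioi (0 : ℝ), HasDerivWithinAt (fun u : ℝ ↦ t' * u / √(1 + u ^ 2))
      (t' / ((1 + u ^ 2) * √(1 + u ^ 2))) (Set.Ioi 0) u := by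
    intro u hu
    have hp : 0 < 1 + u ^ 2 := by positivity
    have h2 : √(1 + u ^ 2) ≠ 0 := by positivity
    have h3 := ((hasDerivAt_id u).const_mul t').div
      ((((hasDerivAt_pow 2 u).const_add 1)).sqrt hp.ne') h2
    refine (h3.congr_deriv ?_).hasDerivWithinAt
    have h4 := Real.sq_sqrt hp.le
    simp only [id]
    field_simp
    rw [h4]
    push_cast
    ring
  have hmono : MonotoneOn (fun u : ℝ ↦ t' * u / √(1 + u ^ 2)) (Set.Ioi 0) := by
    refine monotoneOn_of_deriv_nonneg (convex_Ioi 0) ?_ ?_ fun u hu ↦ ?_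
    · exact fun u hu ↦ (hd u hu).continuousWithinAt
    · rw [interior_Ioi]
      exact fun u hu ↦ (hd u hu).differentiableWithinAt
    · rw [interior_Ioi] at hu
      rw [((hd u hu).hasDerivAt (Ioi_mem_nhds hu)).deriv]
      positivity
  have heq : Set.EqOn (fun u : ℝ ↦ (t' / ((1 + u ^ 2) * √(1 + u ^ 2))) •
      g (t' * u / √(1 + u ^ 2))) (fun u ↦ (t' / √t) * landenIntegrand κ u) (Set.Ioi 0) := by
    intro u hu
    have hu0 : 0 < u := hu
    have hp : 0 < 1 + u ^ 2 := by positivity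
    have h4 := Real.sq_sqrt hp.le
    have h1 : (t' * u / √(1 + u ^ 2)) ^ 2 /
        ((t ^ 2 - (t' * u / √(1 + u ^ 2)) ^ 2) * (t' ^ 2 - (t' * u / √(1 + u ^ 2)) ^ 2)) =
        u ^ 2 * (1 + u ^ 2) / (t ^ 2 * (1 + κ ^ 2 * u ^ 2)) := by
      have e1 : (t' * u / √(1 + u ^ 2)) ^ 2 = t' ^ 2 * u ^ 2 / (1 + u ^ 2) := by
        rw [div_pow, h4, mul_pow]
      have e2 : t' ^ 2 = t ^ 2 * (1 - κ ^ 2) := by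
        rw [hκsq]; field_simp; ring
      have e3 : t ^ 2 - t' ^ 2 * u ^ 2 / (1 + u ^ 2) =
          t ^ 2 * (1 + κ ^ 2 * u ^ 2) / (1 + u ^ 2) := by
        rw [e2]; field_simp; ring
      have e4 : t' ^ 2 - t' ^ 2 * u ^ 2 / (1 + u ^ 2) = t' ^ 2 / (1 + u ^ 2) := by
        field_simp; ring
      rw [e1, e3, e4]
      field_simp
    simp only [landenIntegrand, smul_eq_mul, hg]
    rw [h1]
    refine (pow_left_inj₀ (by positivity) (by positivity) (show 4 ≠ 0 by norm_num)).1 ?_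
    simp only [mul_pow, div_pow]
    rw [quarticRoot_pow_four (by positivity), quarticRoot_pow_four (by positivity),
      show √(1 + u ^ 2) ^ 4 = (1 + u ^ 2) ^ 2 by
        rw [show √(1 + u ^ 2) ^ 4 = (√(1 + u ^ 2) ^ 2) ^ 2 by ring, h4],
      show √t ^ 4 = t ^ 2 by rw [show √t ^ 4 = (√t ^ 2) ^ 2 by ring, Real.sq_sqrt ht.le]]
    field_simp
  have hIoo : Set.Ioo 0 t' ∩ Set.Ioi 0 = Set.Ioo 0 t' := Set.inter_eq_left.2 Set.Ioo_subset_Ioi_self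
  have hconst : t' / √t * landenIntegral κ =
      (1 / 2 * beta (3 / 4) (3 / 4)) * (√(t + t') - √(t - t')) := by
    have h1 := landenIntegral_mul_sqrt_eq hκn
    -- Both sides are nonnegative with square `2t(1-κ)`, because `√(t+t') √(t-t') = tκ`.
    have h2 : t' / √t * (√2 / √(1 + κ)) = √(t + t') - √(t - t') := by
      have hle : √(t - t') ≤ √(t + t') := Real.sqrt_le_sqrt (by linarith)
      refine (pow_left_inj₀ (by positivity) (sub_nonneg.2 hle) (show 2 ≠ 0 by norm_num)).1 ?_
      have h3 : √(t + t') * √(t - t') = t * κ := by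
        rw [← Real.sqrt_mul (by positivity), hκ]
        nth_rewrite 3 [← Real.sqrt_sq ht.le]
        rw [← Real.sqrt_mul (by positivity)]
        congr 1
        field_simp
        ring
      rw [sub_sq, mul_assoc, h3, Real.sq_sqrt (by positivity), Real.sq_sqrt (by linarith)]
      simp only [mul_pow, div_pow]
      rw [Real.sq_sqrt ht.le, Real.sq_sqrt (by positivity), Real.sq_sqrt (by positivity)]
      have e2 : t' ^ 2 = t ^ 2 * (1 - κ ^ 2) := by
        rw [hκsq]; field_simp; ring
      rw [e2]
      field_simp
      ring
    rw [← h2, ← landenIntegral_one]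
    have h5 : √(1 + κ) ≠ 0 := by positivity
    rw [eq_div_iff h5 |>.2 h1]
    ring
  rw [integrableOn_indicator_iff measurableSet_Ioo, hIoo,
    setIntegral_indicator measurableSet_Ioo, Set.inter_comm, hIoo, ← hconst, landenIntegral,
    ← integral_const_mul, ← setIntegral_congr_fun measurableSet_Ioi heq,
    ← integral_image_eq_integral_deriv_smul_of_monotoneOn measurableSet_Ioi hd hmono g,
    image_mul_div_sqrt_Ioi h0]
  refine ⟨?_, rfl⟩
  rw [← image_mul_div_sqrt_Ioi h0, integrableOn_image_iff_integrableOn_deriv_smul_of_monotoneOn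
    measurableSet_Ioi hd hmono, integrableOn_congr_fun heq measurableSet_Ioi]
  exact ((integrable_landenIntegrand κ).const_mul _).integrableOn

theorem memLp_rootKernel {t : ℝ} (ht : 0 ≤ t) :
    MemLp (rootKernel t) 2 (volume.restrict (Set.Ioi 0)) := by
  rw [memLp_two_iff_integrable_sq (measurable_rootKernel t).aestronglyMeasurable]
  simpa only [pow_two, IntegrableOn] using (integrableOn_and_integral_rootKernel_mul ht le_rfl).1

theorem inner_toLp_rootKernel {t t' : ℝ} (h0 : 0 ≤ t') (h : t' ≤ t) :
    inner ℝ ((memLp_rootKernel (h0.trans h)).toLp (rootKernel t))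
      ((memLp_rootKernel h0).toLp (rootKernel t')) =
      (1 / 2 * beta (3 / 4) (3 / 4)) * (√(t + t') - √(t - t')) := by
  rw [L2.inner_def, ← (integrableOn_and_integral_rootKernel_mul h0 h).2]
  refine integral_congr_ae ?_
  filter_upwards [(memLp_rootKernel (h0.trans h)).coeFn_toLp, (memLp_rootKernel h0).coeFn_toLp]
    with s h1 h2
  rw [h1, h2]
  exact mul_comm _ _

end RootKernel

/-! ### Increment sums of step functions in Hilbert spaces. -/

namespace StepFun

/-- The increment sum `∑ i, coeff i • (e (right i) - e (left i))` in a vector space. -/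
def lift {E : Type*} [AddCommGroup E] [Module ℝ E] (φ : StepFun) (e : ℝ≥0 → E) : E :=
  ∑ i, φ.coeff i • (e (φ.right i) - e (φ.left i))

/-- Inner products of increment sums depend only on the Gram kernel. Applied to indicators of
`(0,u]` and to `b u`, both with kernel `min u v`, this is the Wiener isometry on step functions. -/
theorem inner_lift_lift {E F : Type*} [NormedAddCommGroup E] [InnerProductSpace ℝ E]
    [NormedAddCommGroup F] [InnerProductSpace ℝ F] {e : ℝ≥0 → E} {f : ℝ≥0 → F}
    (h : ∀ u v, inner ℝ (e u) (e v) = inner ℝ (f u) (f v)) (φ ψ : StepFun) :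
    inner ℝ (φ.lift e) (ψ.lift e) = inner ℝ (φ.lift f) (ψ.lift f) := by
  simp only [lift, sum_inner, inner_sum, real_inner_smul_left, real_inner_smul_right,
    inner_sub_left, inner_sub_right, h]

theorem dist_lift_lift {E F : Type*} [NormedAddCommGroup E] [InnerProductSpace ℝ E]
    [NormedAddCommGroup F] [InnerProductSpace ℝ F] {e : ℝ≥0 → E} {f : ℝ≥0 → F}
    (h : ∀ u v, inner ℝ (e u) (e v) = inner ℝ (f u) (f v)) (φ ψ : StepFun) :
    dist (φ.lift e) (ψ.lift e) = dist (φ.lift f) (ψ.lift f) := by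
  rw [dist_eq_norm, dist_eq_norm, ← pow_left_inj₀ (norm_nonneg _) (norm_nonneg _) two_ne_zero,
    ← real_inner_self_eq_norm_sq, ← real_inner_self_eq_norm_sq]
  simp only [inner_sub_left, inner_sub_right, inner_lift_lift h]

theorem coeFn_lift_toLp {α : Type*} [MeasurableSpace α] {μ : Measure α} {X : ℝ≥0 → α → ℝ}
    (hX : ∀ u, MemLp (X u) 2 μ) (φ : StepFun) :
    ↑(φ.lift fun u ↦ (hX u).toLp (X u)) =ᵐ[μ] φ.integral X := by
  have h1 : ∀ᵐ ω ∂μ, ∀ i, (φ.coeff i • ((hX (φ.right i)).toLp (X (φ.right i)) -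
      (hX (φ.left i)).toLp (X (φ.left i)))) ω =
        φ.coeff i * (X (φ.right i) ω - X (φ.left i) ω) := by
    rw [ae_all_iff]
    intro i
    filter_upwards [Lp.coeFn_smul (φ.coeff i) ((hX (φ.right i)).toLp (X (φ.right i)) -
        (hX (φ.left i)).toLp (X (φ.left i))), Lp.coeFn_sub ((hX (φ.right i)).toLp (X (φ.right i)))
        ((hX (φ.left i)).toLp (X (φ.left i))), (hX (φ.right i)).coeFn_toLp,
        (hX (φ.left i)).coeFn_toLp] with ω h1 h2 h3 h4
    rw [h1, Pi.smul_apply, h2, Pi.sub_apply, h3, h4, smul_eq_mul]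
  filter_upwards [h1, Lp.coeFn_finsetSum Finset.univ fun i ↦ φ.coeff i •
    ((hX (φ.right i)).toLp (X (φ.right i)) - (hX (φ.left i)).toLp (X (φ.left i)))] with ω h1 h2
  rw [lift, h2, Finset.sum_apply]
  exact Finset.sum_congr rfl fun i _ ↦ h1 i

/-- A step function is the integral of itself against the primitives of point masses. -/
theorem integral_indicator (φ : StepFun) :
    φ.integral (fun u : ℝ≥0 ↦ (Set.Ioc 0 (u : ℝ)).indicator fun _ ↦ (1 : ℝ)) = φ.eval := by
  ext s
  refine Finset.sum_congr rfl fun i _ ↦ ?_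
  have hle : (φ.left i : ℝ) ≤ φ.right i := by exact_mod_cast φ.left_le_right i
  have h0 : (0 : ℝ) ≤ φ.left i := (φ.left i).coe_nonneg
  simp only [Set.indicator_apply, Set.mem_Ioc]
  by_cases h1 : (φ.left i : ℝ) < s
  · have h2 : 0 < s := h0.trans_lt h1
    by_cases h3 : s ≤ φ.right i <;> simp [h1, h2, h3, h1.not_ge]
  · push Not at h1
    simp [h1, h1.trans hle, h1.not_gt]

end StepFun

/-! ### The Wiener integral: isometry, existence and Gaussianity. -/

section WienerIntegral

variable {Ω : Type*} [MeasurableSpace Ω] {Q : Measure Ω} {b : ℝ≥0 → Ω → ℝ}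

theorem memLp_indicator_Ioc (u : ℝ≥0) :
    MemLp ((Set.Ioc 0 (u : ℝ)).indicator fun _ ↦ (1 : ℝ)) 2 (volume.restrict (Set.Ioi 0)) :=
  memLp_indicator_const 2 measurableSet_Ioc 1 (Or.inr (measure_lt_top_of_subset
    (t := Set.Ioc 0 (u : ℝ)) subset_rfl (ne_top_of_le_ne_top measure_Ioc_lt_top.ne
      (Measure.restrict_apply_le _ _))).ne)

theorem inner_indicator_Ioc (u v : ℝ≥0) :
    inner ℝ ((memLp_indicator_Ioc u).toLp _) ((memLp_indicator_Ioc v).toLp _) = min (u : ℝ) v := by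
  have h1 : inner ℝ ((memLp_indicator_Ioc u).toLp _) ((memLp_indicator_Ioc v).toLp _) =
      ∫ s in Set.Ioi (0 : ℝ), (Set.Ioc 0 (min u v : ℝ)).indicator (fun _ ↦ (1 : ℝ)) s := by
    rw [L2.inner_def]
    refine integral_congr_ae ?_
    filter_upwards [(memLp_indicator_Ioc u).coeFn_toLp, (memLp_indicator_Ioc v).coeFn_toLp]
      with s h1 h2
    rw [h1, h2]
    simp only [Set.indicator_apply, Set.mem_Ioc, le_min_iff]
    by_cases h3 : 0 < s <;> by_cases h4 : s ≤ u <;> by_cases h5 : s ≤ v <;> simp [h3, h4, h5]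
  rw [h1, setIntegral_indicator measurableSet_Ioc, Set.inter_eq_right.2 Set.Ioc_subset_Ioi_self]
  simp

namespace ProbabilityTheory.IsPreBrownianReal

theorem memLp_two (hb : IsPreBrownianReal b Q) (u : ℝ≥0) : MemLp (b u) 2 Q :=
  (hb.isGaussianProcess.hasGaussianLaw_eval u).memLp_two

theorem inner_toLp (hb : IsPreBrownianReal b Q) (u v : ℝ≥0) :
    inner ℝ ((hb.memLp_two u).toLp (b u)) ((hb.memLp_two v).toLp (b v)) =
      inner ℝ ((memLp_indicator_Ioc u).toLp _) ((memLp_indicator_Ioc v).toLp _) := by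
  have := hb.isGaussianProcess.isProbabilityMeasure
  have h := hb.covariance_eval u v
  rw [covariance_eq_sub (hb.memLp_two u) (hb.memLp_two v), hb.integral_eval, zero_mul,
    sub_zero] at h
  rw [inner_indicator_Ioc, ← NNReal.coe_min, ← h, L2.inner_def]
  refine integral_congr_ae ?_
  filter_upwards [(hb.memLp_two u).coeFn_toLp, (hb.memLp_two v).coeFn_toLp] with ω h1 h2
  rw [h1, h2]
  exact mul_comm _ _

/-- The closed linear span of a Brownian motion in `L²`. -/
noncomputable def gaussianSpace (hb : IsPreBrownianReal b Q) : Submodule ℝ (Lp ℝ 2 Q) :=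
  (Submodule.span ℝ (Set.range fun u ↦ (hb.memLp_two u).toLp (b u))).topologicalClosure

/-- Being Gaussian and having mean zero are closed conditions in `L²`, so it suffices to check
finite linear combinations of values of `b`. -/
theorem hasGaussianLaw_of_mem_gaussianSpace (hb : IsPreBrownianReal b Q) {Z : Lp ℝ 2 Q}
    (hZ : Z ∈ hb.gaussianSpace) : HasGaussianLaw Z Q ∧ ∫ ω, Z ω ∂Q = 0 := by
  have := hb.isGaussianProcess.isProbabilityMeasure
  have hcl : IsClosed {Z : Lp ℝ 2 Q | HasGaussianLaw Z Q ∧ ∫ ω, Z ω ∂Q = 0} :=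
    isClosed_setOf_hasGaussianLaw.inter
      (isClosed_eq LipschitzWith.id.continuous_integral_Lp continuous_const)
  refine closure_minimal (fun Z hZ ↦ ?_) hcl hZ
  obtain ⟨c, rfl⟩ := Finsupp.mem_span_range_iff_exists_finsupp.1 hZ
  have hae : (fun ω ↦ ∑ u ∈ c.support, c u * b u ω) =ᵐ[Q]
      ↑(c.sum fun u a ↦ a • (hb.memLp_two u).toLp (b u)) := by
    have h1 : ∀ᵐ ω ∂Q, ∀ u ∈ c.support, (c u • (hb.memLp_two u).toLp (b u)) ω = c u * b u ω := by
      rw [eventually_all_finset]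
      intro u _
      filter_upwards [Lp.coeFn_smul (c u) ((hb.memLp_two u).toLp (b u)),
        (hb.memLp_two u).coeFn_toLp] with ω h1 h2
      rw [h1, Pi.smul_apply, h2, smul_eq_mul]
    filter_upwards [h1, Lp.coeFn_finsetSum c.support fun u ↦ c u • (hb.memLp_two u).toLp (b u)]
      with ω h1 h2
    rw [Finsupp.sum, h2, Finset.sum_apply]
    exact (Finset.sum_congr rfl h1).symm
  refine ⟨HasGaussianLaw.congr ?_ hae, ?_⟩
  · have h2 := (hb.isGaussianProcess.hasGaussianLaw c.support).map
      (∑ u : c.support, c u • ContinuousLinearMap.proj (R := ℝ) u)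
    refine h2.congr (ae_of_all _ fun ω ↦ ?_)
    rw [Function.comp_apply, sum_apply]
    exact Finset.sum_coe_sort c.support fun u ↦ c u * b u ω
  · rw [← integral_congr_ae hae, integral_finsetSum _ fun u _ ↦ (hb.integrable_eval u).const_mul _]
    simp [integral_const_mul, hb.integral_eval]

theorem lift_mem_gaussianSpace (hb : IsPreBrownianReal b Q) (φ : StepFun) :
    (φ.lift fun u ↦ (hb.memLp_two u).toLp (b u)) ∈ hb.gaussianSpace := by
  refine Submodule.le_topologicalClosure _ (Submodule.sum_mem _ fun i _ ↦ ?_)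
  exact Submodule.smul_mem _ _ (Submodule.sub_mem _ (Submodule.subset_span ⟨_, rfl⟩)
    (Submodule.subset_span ⟨_, rfl⟩))

end ProbabilityTheory.IsPreBrownianReal

/-- This recasts the definition as convergence of the same increment sums in two Hilbert spaces, so
that the isometry applies. -/
theorem hasWienerIntegral_iff (hb : IsPreBrownianReal b Q) {f : ℝ → ℝ} {X : Ω → ℝ}
    (hf : MemLp f 2 (volume.restrict (Set.Ioi 0))) (hX : MemLp X 2 Q) :
    HasWienerIntegral b Q f X ↔ ∃ φ : ℕ → StepFun,
      Tendsto (fun n ↦ (φ n).lift fun u ↦ (memLp_indicator_Ioc u).toLp _) atTop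
        (𝓝 (hf.toLp f)) ∧
      Tendsto (fun n ↦ (φ n).lift fun u ↦ (hb.memLp_two u).toLp (b u)) atTop
        (𝓝 (hX.toLp X)) := by
  simp only [HasWienerIntegral, hf, hX, true_and, Lp.tendsto_Lp_iff_tendsto_eLpNorm]
  refine exists_congr fun φ ↦ and_congr (tendsto_congr fun n ↦ ?_) (tendsto_congr fun n ↦ ?_)
  · refine eLpNorm_congr_ae ?_
    filter_upwards [StepFun.coeFn_lift_toLp memLp_indicator_Ioc (φ n)] with s hs
    rw [Pi.sub_apply, hs, StepFun.integral_indicator]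
  · refine eLpNorm_congr_ae ?_
    filter_upwards [StepFun.coeFn_lift_toLp hb.memLp_two (φ n)] with s hs
    rw [Pi.sub_apply, hs]

/-- The Wiener isometry. -/
theorem HasWienerIntegral.inner_eq (hb : IsPreBrownianReal b Q) {f g : ℝ → ℝ} {X Y : Ω → ℝ}
    (hX : HasWienerIntegral b Q f X) (hY : HasWienerIntegral b Q g Y) :
    inner ℝ (hX.2.1.toLp X) (hY.2.1.toLp Y) = inner ℝ (hX.1.toLp f) (hY.1.toLp g) := by
  obtain ⟨φ, hφ, hφ'⟩ := (hasWienerIntegral_iff hb hX.1 hX.2.1).1 hX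
  obtain ⟨ψ, hψ, hψ'⟩ := (hasWienerIntegral_iff hb hY.1 hY.2.1).1 hY
  refine tendsto_nhds_unique (hφ'.inner hψ') ?_
  simp only [StepFun.inner_lift_lift hb.inner_toLp]
  exact hφ.inner hψ

theorem HasWienerIntegral.mem_gaussianSpace (hb : IsPreBrownianReal b Q) {f : ℝ → ℝ} {X : Ω → ℝ}
    (hX : HasWienerIntegral b Q f X) : hX.2.1.toLp X ∈ hb.gaussianSpace := by
  obtain ⟨φ, -, hφ⟩ := (hasWienerIntegral_iff hb hX.1 hX.2.1).1 hX
  exact (Submodule.isClosed_topologicalClosure _).mem_of_tendsto hφ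
    (Eventually.of_forall fun n ↦ hb.lift_mem_gaussianSpace (φ n))

/-- A limit in `L²` of step functions has a Wiener integral. -/
theorem exists_hasWienerIntegral (hb : IsPreBrownianReal b Q) {f : ℝ → ℝ}
    (hf : MemLp f 2 (volume.restrict (Set.Ioi 0))) {φ : ℕ → StepFun}
    (hφ : Tendsto (fun n ↦ eLpNorm (fun s ↦ (φ n).eval s - f s) 2 (volume.restrict (Set.Ioi 0)))
      atTop (𝓝 0)) :
    ∃ X : Ω → ℝ, HasWienerIntegral b Q f X := by
  have h1 : Tendsto (fun n ↦ (φ n).lift fun u ↦ (memLp_indicator_Ioc u).toLp _) atTop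
      (𝓝 (hf.toLp f)) := by
    rw [Lp.tendsto_Lp_iff_tendsto_eLpNorm]
    refine hφ.congr fun n ↦ eLpNorm_congr_ae ?_
    filter_upwards [StepFun.coeFn_lift_toLp memLp_indicator_Ioc (φ n)] with s hs
    rw [Pi.sub_apply, hs, StepFun.integral_indicator]
  -- The isometry transfers the Cauchy property from `L²(0,∞)` to `L²(Q)`, which is complete.
  have h2 : CauchySeq fun n ↦ (φ n).lift fun u ↦ (hb.memLp_two u).toLp (b u) := by
    have := h1.cauchySeq
    rw [Metric.cauchySeq_iff] at this ⊢
    simpa only [StepFun.dist_lift_lift hb.inner_toLp] using this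
  obtain ⟨Z, hZ⟩ := cauchySeq_tendsto_of_complete h2
  refine ⟨Z, (hasWienerIntegral_iff hb hf (Lp.memLp Z)).2 ⟨φ, h1, ?_⟩⟩
  rwa [Lp.toLp_coeFn]

/-- Wiener integrals with respect to the same Brownian motion form a Gaussian process. -/
theorem isGaussianProcess_of_hasWienerIntegral {T : Type*} (hb : IsPreBrownianReal b Q)
    {f : T → ℝ → ℝ} {X : T → Ω → ℝ} (hX : ∀ t, HasWienerIntegral b Q (f t) (X t)) :
    IsGaussianProcess X Q := by
  refine isGaussianProcess_of_hasGaussianLaw_sum fun I c ↦ ?_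
  have hmem : ∑ i ∈ I, c i • (hX i).2.1.toLp (X i) ∈ hb.gaussianSpace :=
    Submodule.sum_mem _ fun i _ ↦ Submodule.smul_mem _ _ ((hX i).mem_gaussianSpace hb)
  refine (hb.hasGaussianLaw_of_mem_gaussianSpace hmem).1.congr ?_
  have h1 : ∀ᵐ ω ∂Q, ∀ i ∈ I, (c i • (hX i).2.1.toLp (X i)) ω = c i * X i ω := by
    rw [eventually_all_finset]
    intro i _
    filter_upwards [Lp.coeFn_smul (c i) ((hX i).2.1.toLp (X i)), (hX i).2.1.coeFn_toLp]
      with ω h1 h2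
    rw [h1, Pi.smul_apply, h2, smul_eq_mul]
  filter_upwards [h1, Lp.coeFn_finsetSum I fun i ↦ c i • (hX i).2.1.toLp (X i)] with ω h1 h2
  rw [h2, Finset.sum_apply]
  exact Finset.sum_congr rfl h1

theorem HasWienerIntegral.integral_eq_zero (hb : IsPreBrownianReal b Q) {f : ℝ → ℝ} {X : Ω → ℝ}
    (hX : HasWienerIntegral b Q f X) : ∫ ω, X ω ∂Q = 0 := by
  rw [← integral_congr_ae hX.2.1.coeFn_toLp]
  exact (hb.hasGaussianLaw_of_mem_gaussianSpace (hX.mem_gaussianSpace hb)).2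

theorem HasWienerIntegral.covariance_eq (hb : IsPreBrownianReal b Q) {f g : ℝ → ℝ} {X Y : Ω → ℝ}
    (hX : HasWienerIntegral b Q f X) (hY : HasWienerIntegral b Q g Y) :
    cov[X, Y; Q] = inner ℝ (hX.1.toLp f) (hY.1.toLp g) := by
  have := hb.isGaussianProcess.isProbabilityMeasure
  rw [covariance_eq_sub hX.2.1 hY.2.1, hX.integral_eq_zero hb, zero_mul, sub_zero,
    ← hX.inner_eq hb hY, L2.inner_def]
  refine integral_congr_ae ?_
  filter_upwards [hX.2.1.coeFn_toLp, hY.2.1.coeFn_toLp] with ω h1 h2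
  rw [h1, h2]
  exact mul_comm _ _

end WienerIntegral

/-! ### Left endpoint approximation of monotone functions in `L²`. -/

section LeftEndpoint

/-- The step function on `[0, t]` that samples `f` at the left endpoints of `n + 1` equal
intervals. -/
noncomputable def StepFun.leftEndpoint (f : ℝ → ℝ) (t : ℝ≥0) (n : ℕ) : StepFun where
  size := n + 1
  coeff i := f (i * (t / (n + 1)))
  left i := i * (t / (n + 1))
  right i := (i + 1) * (t / (n + 1))
  left_le_right i := by gcongr; simp

theorem StepFun.leftEndpoint_eval_of_lt (f : ℝ → ℝ) {t : ℝ≥0} (n : ℕ) {s : ℝ} (hs : t < s) :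
    (StepFun.leftEndpoint f t n).eval s = 0 := by
  refine Finset.sum_eq_zero fun i _ ↦ Set.indicator_of_notMem (fun h ↦ ?_) _
  have h2 := h.2
  simp only [leftEndpoint] at h2
  push_cast at h2
  have hi : ((i : ℕ) : ℝ) + 1 ≤ n + 1 := by
    have : (i : ℕ) + 1 ≤ n + 1 := i.2
    exact_mod_cast this
  have : (((i : ℕ) : ℝ) + 1) * (t / (n + 1)) ≤ (n + 1) * (t / (n + 1)) := by gcongr
  rw [mul_div_cancel₀ _ (by positivity)] at this
  linarith

theorem StepFun.exists_leftEndpoint_eval (f : ℝ → ℝ) {t : ℝ≥0} (n : ℕ) {s : ℝ} (h0 : 0 < s)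
    (hs : s < t) : ∃ k : ℕ, (StepFun.leftEndpoint f t n).eval s = f (k * (t / (n + 1))) ∧
      k * ((t : ℝ) / (n + 1)) < s ∧ s - t / (n + 1) ≤ k * ((t : ℝ) / (n + 1)) := by
  have ht : (0 : ℝ) < t := h0.trans hs
  set d : ℝ := t / (n + 1) with hd
  have hd0 : 0 < d := by positivity
  -- The cells `(jd, (j+1)d]` are closed on the right, so the index of the cell containing `s` is
  -- `⌈s/d⌉ - 1`.
  have hc0 : 0 < ⌈s / d⌉₊ := Nat.ceil_pos.2 (by positivity)
  obtain ⟨k, hk⟩ : ∃ k, ⌈s / d⌉₊ = k + 1 := ⟨⌈s / d⌉₊ - 1, by lia⟩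
  have huniq : ∀ j : ℕ, s ∈ Set.Ioc (j * d) ((j + 1) * d) ↔ j = k := by
    intro j
    have h1 := Nat.ceil_eq_iff (a := s / d) (n := j + 1) (by lia)
    rw [hk, Nat.add_sub_cancel, lt_div_iff₀ hd0, div_le_iff₀ hd0] at h1
    push_cast at h1
    rw [Set.mem_Ioc, ← h1]
    lia
  obtain ⟨hk1, hk2⟩ := (huniq k).2 rfl
  refine ⟨k, ?_, hk1, by linarith⟩
  have hkn : k < n + 1 := by
    have h1 : (k : ℝ) * d < (n + 1) * d := hk1.trans (by rwa [hd, mul_div_cancel₀ _ (by positivity)])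
    have h2 := lt_of_mul_lt_mul_right h1 hd0.le
    exact_mod_cast h2
  refine (Finset.sum_eq_single (⟨k, hkn⟩ : Fin (n + 1)) ?_
    fun h ↦ absurd (Finset.mem_univ _) h).trans ?_
  · intro j _ hj
    simp only [leftEndpoint]
    push_cast
    refine Set.indicator_of_notMem (fun h ↦ hj ?_) _
    exact Fin.ext ((huniq j).1 h)
  · simp only [leftEndpoint]
    push_cast
    rw [Set.indicator_of_mem ((huniq k).2 rfl)]

/-- Left endpoint approximations of a nonnegative increasing continuous function on `(0, t)`
converge in `L²`. -/
theorem StepFun.tendsto_eLpNorm_leftEndpoint {f : ℝ → ℝ} {t : ℝ≥0}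
    (hf : MemLp f 2 (volume.restrict (Set.Ioi 0))) (hf0 : ∀ s, 0 ≤ f s)
    (hsupp : ∀ s, s ∉ Set.Ioo 0 (t : ℝ) → f s = 0) (hmono : MonotoneOn f (Set.Ioo 0 (t : ℝ)))
    (hcont : ContinuousOn f (Set.Ioo 0 (t : ℝ))) :
    Tendsto (fun n ↦ eLpNorm (fun s ↦ (StepFun.leftEndpoint f t n).eval s - f s) 2
      (volume.restrict (Set.Ioi 0))) atTop (𝓝 0) := by
  have hne : ∀ᵐ s : ℝ ∂volume.restrict (Set.Ioi 0), 0 < s ∧ s ≠ (t : ℝ) := by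
    rw [ae_restrict_iff' measurableSet_Ioi]
    filter_upwards [Measure.ae_ne volume (t : ℝ)] with s h1 h2
    exact ⟨h2, h1⟩
  have hmeas : ∀ φ : StepFun, Measurable φ.eval := fun φ ↦
    Finset.measurable_fun_sum _ fun i _ ↦ measurable_const.indicator measurableSet_Ioc
  -- Sampling an increasing function to the left of `s` gives a value in `[0, f s]`, so the error is
  -- dominated by `f` itself, even if `f` is unbounded near `t`.
  have hbound : ∀ n, ∀ᵐ s ∂volume.restrict (Set.Ioi (0 : ℝ)),
      ‖(StepFun.leftEndpoint f t n).eval s - f s‖ₑ ^ (2 : ℝ) ≤ ‖f s‖ₑ ^ (2 : ℝ) := by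
    intro n
    filter_upwards [hne] with s ⟨h0, hst⟩
    gcongr
    rw [enorm_le_iff_norm_le, Real.norm_eq_abs, Real.norm_eq_abs, abs_of_nonneg (hf0 s), abs_le]
    rcases lt_or_gt_of_ne hst with h | h
    · obtain ⟨k, hk, hk1, -⟩ := StepFun.exists_leftEndpoint_eval f n h0 h
      rw [hk]
      have h1 := hf0 (k * (t / (n + 1)))
      refine ⟨by linarith, ?_⟩
      have h2 : f (k * (t / (n + 1))) ≤ f s := by
        -- The first cell samples at `0`, outside the open interval, where `f` vanishes.
        by_cases hm : (k * ((t : ℝ) / (n + 1))) ∈ Set.Ioo 0 (t : ℝ)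
        · exact hmono hm ⟨h0, h⟩ hk1.le
        · rw [hsupp _ hm]
          exact hf0 s
      linarith [hf0 s]
    · rw [StepFun.leftEndpoint_eval_of_lt f n h, hsupp s fun hs ↦ hs.2.not_gt h]
      simp
  have hlim : ∀ᵐ s ∂volume.restrict (Set.Ioi (0 : ℝ)),
      Tendsto (fun n ↦ ‖(StepFun.leftEndpoint f t n).eval s - f s‖ₑ ^ (2 : ℝ)) atTop (𝓝 0) := by
    filter_upwards [hne] with s ⟨h0, hst⟩
    have h1 : Tendsto (fun n ↦ (StepFun.leftEndpoint f t n).eval s - f s) atTop (𝓝 0) := by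
      rw [tendsto_sub_nhds_zero_iff]
      rcases lt_or_gt_of_ne hst with h | h
      · choose k hk hk1 hk2 using fun n ↦ StepFun.exists_leftEndpoint_eval f (t := t) n h0 h
        simp only [hk]
        have hc : ContinuousAt f s := hcont.continuousAt (Ioo_mem_nhds h0 h)
        refine hc.tendsto.comp (tendsto_of_tendsto_of_tendsto_of_le_of_le ?_ tendsto_const_nhds
          hk2 fun n ↦ (hk1 n).le)
        have := (tendsto_one_div_add_atTop_nhds_zero_nat (𝕜 := ℝ)).const_mul (t : ℝ)
        simpa [div_eq_mul_inv] using this.const_sub s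
      · simp only [StepFun.leftEndpoint_eval_of_lt f _ h, hsupp s fun hs ↦ hs.2.not_gt h]
        exact tendsto_const_nhds
    have h2 := (ENNReal.continuous_rpow_const (y := 2)).tendsto 0 |>.comp
      (continuous_enorm.tendsto' (0 : ℝ) 0 (by simp) |>.comp h1)
    rwa [ENNReal.zero_rpow_of_pos two_pos] at h2
  have hfin : ∫⁻ s in Set.Ioi (0 : ℝ), ‖f s‖ₑ ^ (2 : ℝ) ≠ ∞ := by
    have := (eLpNorm_lt_top_iff_lintegral_rpow_enorm_lt_top two_ne_zero ENNReal.ofNat_ne_top).1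
      hf.eLpNorm_lt_top
    simpa using this.ne
  have hDCT := tendsto_lintegral_of_dominated_convergence' (fun s ↦ ‖f s‖ₑ ^ (2 : ℝ))
    (fun n ↦ (((hmeas (StepFun.leftEndpoint f t n)).aemeasurable.sub
      hf.aestronglyMeasurable.aemeasurable).enorm.pow_const 2)) hbound hfin hlim
  rw [lintegral_zero] at hDCT
  have h3 := (ENNReal.continuous_rpow_const (y := 1 / 2)).tendsto 0 |>.comp hDCT
  rw [ENNReal.zero_rpow_of_pos (by norm_num)] at h3
  refine h3.congr fun n ↦ ?_
  rw [eLpNorm_eq_lintegral_rpow_enorm_toReal two_ne_zero ENNReal.ofNat_ne_top]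
  simp

end LeftEndpoint

/-! ### The root process as a Wiener integral, and the main theorem. -/

section RootWiener

variable {Ω : Type*} [MeasurableSpace Ω] {Q : Measure Ω} {b : ℝ≥0 → Ω → ℝ}

theorem rootKernel_of_mem {t s : ℝ} (hs : s ∈ Set.Ioo 0 t) :
    rootKernel t s = s ^ (1 / 4 : ℝ) / (t ^ 2 - s ^ 2) ^ (1 / 4 : ℝ) := if_pos hs

theorem monotoneOn_rootKernel (t : ℝ) : MonotoneOn (rootKernel t) (Set.Ioo 0 t) := by
  intro u hu v hv huv
  rw [rootKernel_of_mem hu, rootKernel_of_mem hv]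
  have h1 : 0 < t ^ 2 - v ^ 2 := by nlinarith [hv.1, hv.2]
  have := hu.1
  have := hv.1
  gcongr

theorem continuousOn_rootKernel (t : ℝ) : ContinuousOn (rootKernel t) (Set.Ioo 0 t) := by
  refine ContinuousOn.congr (f := fun s ↦ s ^ (1 / 4 : ℝ) / (t ^ 2 - s ^ 2) ^ (1 / 4 : ℝ)) ?_
    fun s hs ↦ rootKernel_of_mem hs
  refine ContinuousOn.div ?_ ?_ fun s hs ↦ ?_
  · exact (Real.continuous_rpow_const (by norm_num)).continuousOn
  · exact ((Real.continuous_rpow_const (by norm_num)).comp (by fun_prop)).continuousOn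
  · have h1 : 0 < t ^ 2 - s ^ 2 := by nlinarith [hs.1, hs.2]
    positivity

theorem exists_hasWienerIntegral_rootKernel (hb : IsPreBrownianReal b Q) (t : ℝ≥0) :
    ∃ X : Ω → ℝ, HasWienerIntegral b Q (rootKernel t) X :=
  exists_hasWienerIntegral hb (memLp_rootKernel t.coe_nonneg)
    (StepFun.tendsto_eLpNorm_leftEndpoint (memLp_rootKernel t.coe_nonneg) (rootKernel_nonneg t)
      (fun _ hs ↦ if_neg hs) (monotoneOn_rootKernel t) (continuousOn_rootKernel t))

/-- The isometry gives covariance `½B(3/4,3/4)(√(t+t') - √(t-t'))`, and the square of the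
normalizing constant cancels the beta factor. -/
theorem isRootProcess_of_hasWienerIntegral (hb : IsPreBrownianReal b Q) {X : ℝ≥0 → Ω → ℝ}
    (hX : ∀ t : ℝ≥0, HasWienerIntegral b Q (rootKernel t) (X t)) :
    IsRootProcess (fun t ω ↦ ((1 / 2) * beta (3 / 4) (3 / 4)) ^ (-(1 / 2) : ℝ) * X t ω) Q := by
  have hB : 0 < (1 / 2) * beta (3 / 4) (3 / 4) := by
    have := beta_pos (α := 3 / 4) (β := 3 / 4) (by norm_num) (by norm_num)
    positivity
  refine ⟨(isGaussianProcess_of_hasWienerIntegral hb hX).smul fun _ ↦ _, fun t ↦ ?_,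
    fun t t' h ↦ ?_⟩
  · rw [integral_const_mul, (hX t).integral_eq_zero hb, mul_zero]
  · rw [covariance_const_mul_left, covariance_const_mul_right, (hX t).covariance_eq hb (hX t'),
      inner_toLp_rootKernel t'.coe_nonneg (by exact_mod_cast h), ← mul_assoc, ← mul_assoc,
      ← Real.rpow_add hB]
    norm_num
    rw [Real.rpow_neg_one, inv_mul_cancel₀ (by simpa using hB.ne'), one_mul]

end RootWiener

theorem theorem2 :
    -- a centered Gaussian process with this covariance exists
    (∃ (Ω : Type) (_ : MeasurableSpace Ω) (P : Measure Ω) (r : ℝ≥0 → Ω → ℝ),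
      IsRootProcess r P) ∧
    ∀ {Ω : Type*} [MeasurableSpace Ω] (P : Measure Ω) (r : ℝ≥0 → Ω → ℝ), IsRootProcess r P →
      -- continuous version
      (∃ Y : ℝ≥0 → Ω → ℝ, IsContinuousVersion Y r P) ∧
      -- self-similarity
      IsSelfSimilar (1 / 4) r P ∧
      -- odd part of fractional Brownian motion
      (∀ {Ω₁ : Type*} [MeasurableSpace Ω₁] (Q : Measure Ω₁) (ν : ℝ → Ω₁ → ℝ),
        IsTwoSidedFBM (1 / 4) ν Q →
          ProcessEqLaw r P (fun (t : ℝ≥0) ω ↦ 2 * oddPart ν t ω) Q) ∧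
      -- stochastic heat equation with zero initial condition
      (∀ {Ω₂ : Type*} [MeasurableSpace Ω₂] (Q : Measure Ω₂)
        (W : Lp ℝ 2 spaceTimeVolume → Ω₂ → ℝ), IsWhiteNoise spaceTimeVolume W Q →
          (∃ h : ℝ → ℝ≥0 → Ω₂ → ℝ, IsStochasticHeatSolution W Q (fun _ ↦ 0) h) ∧
          ∀ h : ℝ → ℝ≥0 → Ω₂ → ℝ, IsStochasticHeatSolution W Q (fun _ ↦ 0) h →
            ProcessEqLaw r P (fun t ω ↦ (2 * Real.pi) ^ (1 / 4 : ℝ) * h 0 t ω) Q) ∧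
      -- integral with respect to Brownian motion
      (∀ {Ω₃ : Type*} [MeasurableSpace Ω₃] (Q : Measure Ω₃) (b : ℝ≥0 → Ω₃ → ℝ),
        IsBrownianReal b Q →
          (∃ X : ℝ≥0 → Ω₃ → ℝ, ∀ t : ℝ≥0, HasWienerIntegral b Q (rootKernel t) (X t)) ∧
          ∀ X : ℝ≥0 → Ω₃ → ℝ, (∀ t : ℝ≥0, HasWienerIntegral b Q (rootKernel t) (X t)) →
            ProcessEqLaw r P
              (fun t ω ↦ ((1 / 2) * beta (3 / 4) (3 / 4)) ^ (-(1 / 2) : ℝ) * X t ω) Q) := by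
  refine ⟨exists_isRootProcess, fun P r hr ↦ ⟨hr.exists_isContinuousVersion, hr.isSelfSimilar,
    fun Q ν hν ↦ hr.processEqLaw hν.isRootProcess,
    fun Q W hW ↦ ⟨exists_isStochasticHeatSolution W Q,
      fun h hh ↦ hr.processEqLaw (hh.isRootProcess hW)⟩,
    fun Q b hb ↦ ⟨?_, fun X hX ↦
      hr.processEqLaw (isRootProcess_of_hasWienerIntegral hb.toIsPreBrownianReal hX)⟩⟩⟩
  choose X hX using exists_hasWienerIntegral_rootKernel hb.toIsPreBrownianReal
  exact ⟨X, hX⟩
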